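/- **Theorem (Network optimal state estimation).** Let $\alpha>0$, $\varepsilon_1,\dots,\varepsilon_n>0$, let $W_1,\dots,W_n$ be independent standard Brownian motions, let $X_m$ ($1\le m\le n$) be the Ornstein–Uhlenbeck process $dX_m=-\alpha X_m\,dt+\varepsilon_m\,dW_m$, $X_m(0)=0$, i.e. the continuous solution of $X_m(t)=-\alpha\int_0^tX_m(s)\,ds+\varepsilon_mW_m(t)$, and put $X_0\equiv 0$ (reference clock). Let $E$ be a set of directed links $(i,j)$, $i\ne j$, between the nodes $0,\dots,n$. At the instants $t_k\ge 0$ of a deterministic, finite or infinite, set of pairwise distinct times that has finitely many elements in every bounded interval, one link $(i,j)=(i_k,j_k)\in E$ is measured: $$y_{ij}(t_k)=X_j(t_k)-X_i(t_k)+v_{ij}(t_k)=M(t_k)^{T}X(t_k)+v_{ij}(t_k),\qquad v_{ij}(t_k)\sim\mathcal N(0,\sigma_{ij}^2(t_k)),\quad \sigma_{ij}^2(t_k)>0,$$ where $M(t_k)\in\mathbb R^n$ has entries $-1$ at $m=i$, $1$ at $m=j$ and $0$ elsewhere, and the noises $v_{ij}(t_k)$ are independent across $k$ and independent of $(W_m)_m$.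 Let $\mathcal Y_t$ (resp. $\mathcal Y_{t^-}$) be the $\sigma$-algebra generated by the measurements taken at instants $\le t$ (resp. $<t$). The following equations, with the conventions $\hat X_0\equiv 0$ (component of the reference node) and $P_{m0}=P_{0m}=P_{00}=0$ for entries that involve the reference node, have a solution $(\hat X_t,P_t)_{t\ge0}$, right-continuous with left limits. The initial values (before a possible measurement at time $0$) are $\hat X=0\in\mathbb R^n$ and $P=0_{n\times n}$. Between measurements $$\frac{d\hat X_t}{dt}=-\alpha\hat X_t,\qquad \frac{dP_t}{dt}=-2\alpha P_t+E_\varepsilon^2,\qquad E_\varepsilon=\operatorname{diag}(\varepsilon_1,\dots,\varepsilon_n).$$ At a measurement $y_{ij}(t_k)$, for $1\le m,l\le n$, $$(\hat X_{t_k^+})_m=(\hat X_{t_k^-})_m+K_m(t_k)\bigl(y_{ij}(t_k)-\hat X_j(t_k^-)+\hat X_i(t_k^-)\bigr),\qquad K_m(t_k)=\frac{P^{t_k^-}_{mj}-P^{t_k^-}_{mi}}{c_k},$$ $$P^{t_k^+}_{ml}=P^{t_k^-}_{ml}-\frac{(P^{t_k^-}_{mj}-P^{t_k^-}_{mi})(P^{t_k^-}_{jl}-P^{t_k^-}_{il})}{c_k},\qquad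 c_k=P^{t_k^-}_{ii}+P^{t_k^-}_{jj}-2P^{t_k^-}_{ij}+\sigma_{ij}^2(t_k).$$ Every solution of these equations is the optimal filter: 1. For every $t\ge0$, $\hat X_t$ is $\mathcal Y_t$-measurable, $\hat X_t=\mathbb E[X_t\mid\mathcal Y_t]$ a.s., and $\hat X_t$ minimizes the mean square error $\mathbb E\|X_t-U\|_2^2$ over the square integrable $\mathcal Y_t$-measurable $U$. The same holds for $\hat X_{t^-}$ with $\mathcal Y_{t^-}$. 2. The conditional and the unconditional error covariance coincide and are given by $P$: $\mathbb E[(X_t-\hat X_t)(X_t-\hat X_t)^T\mid\mathcal Y_t]=\mathbb E[(X_t-\hat X_t)(X_t-\hat X_t)^T]=P_t$ a.s. for every $t\ge0$, and likewise with $\hat X_{t^-},\mathcal Y_{t^-},P_{t^-}$. 3. The filter is uniformly asymptotically stable: for the unforced filter (the equations of $\hat X$ with all $y_{ij}(t_k)$ replaced by $0$, started at any time $t_0\ge 0$ from any state $x_0$ just before $t_0$), for every $\eta>0$ there is $\delta>0$ such that for all $t_0\ge0$, $\|x_0\|<\delta$ implies $\|x(t)\|<\eta$ for all $t\ge t_0$;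 and for all $r,\eta>0$ there is $\tau>0$ such that for all $t_0\ge0$, $\|x_0\|<r$ implies $\|x(t)\|<\eta$ for all $t\ge t_0+\tau$. 4. The covariance is uniformly bounded: $\sup_{t\ge0}\max_{m,l}|(P_t)_{ml}|<\infty$, and likewise for $P_{t^-}$. -/

import Mathlib

open MeasureTheory ProbabilityTheory Filter Topology
open scoped NNReal

namespace ClockNetwork

/-- Extend a vector indexed by the `n` clocks `1, …, n` to the nodes `0, …, n`: the reference
node `0` has value `0`. Clock `m : Fin n` is node `m.succ`. -/
def withRef {n : ℕ} (x : Fin n → ℝ) : Fin (n + 1) → ℝ := Fin.cons 0 x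

/-- Extend a matrix indexed by the clocks `1, …, n` to the nodes `0, …, n`, with zero row and
column for the reference node `0`. -/
def withRefMatrix {n : ℕ} (P : Matrix (Fin n) (Fin n) ℝ) :
    Matrix (Fin (n + 1)) (Fin (n + 1)) ℝ :=
  fun a b => withRef (fun m => withRef (fun l => P m l) b) a

/-- An asynchronous schedule of measurements over the set `E` of directed links. There is at most
one measurement per time instant, and finitely many in every bounded time interval. At an instant
`t ∈ times` the link is `link t = (i, j)` and the noise variance is `variance t > 0`
(the values of `link` and `variance` outside `times` play no role). -/
structure MeasurementSchedule (n : ℕ) (E : Set (Fin (n + 1) × Fin (n + 1))) where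
  times : Set ℝ
  nonneg : ∀ t ∈ times, 0 ≤ t
  locallyFinite : ∀ t : ℝ, (times ∩ Set.Iic t).Finite
  link : ℝ → Fin (n + 1) × Fin (n + 1)
  link_mem : ∀ t ∈ times, link t ∈ E
  variance : ℝ → ℝ≥0
  variance_pos : ∀ t ∈ times, 0 < variance t

/-- The measurement vector `M` of the link `(i, j)`. -/
def measurementVector {n : ℕ} (e : Fin (n + 1) × Fin (n + 1)) : Fin n → ℝ :=
  fun m => if m.succ = e.1 then -1 else if m.succ = e.2 then 1 else 0

/-- The noisy measurement `y_{ij}(t) = X_j(t) - X_i(t) + v(t)`, where `(i, j) = link t`. -/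
def measurement {n : ℕ} {E : Set (Fin (n + 1) × Fin (n + 1))} {Ω : Type*}
    (S : MeasurementSchedule n E) (X : Fin n → ℝ → Ω → ℝ) (v : ℝ → Ω → ℝ) (t : ℝ) (ω : Ω) : ℝ :=
  withRef (fun m => X m t ω) (S.link t).2 - withRef (fun m => X m t ω) (S.link t).1 + v t ω

lemma withRef_eq_sum {n : ℕ} (x : Fin n → ℝ) (a : Fin (n + 1)) :
    withRef x a = ∑ m, (if m.succ = a then x m else 0) := by
  refine Fin.cases ?_ (fun i => ?_) a
  · simp [withRef]
  · simp [withRef]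

/-- `y_{ij}(t) = M(t)ᵀ X(t) + v(t)`. -/
lemma measurement_eq_dotProduct {n : ℕ} {E : Set (Fin (n + 1) × Fin (n + 1))} {Ω : Type*}
    (S : MeasurementSchedule n E) (X : Fin n → ℝ → Ω → ℝ) (v : ℝ → Ω → ℝ) (t : ℝ) (ω : Ω)
    (h : (S.link t).1 ≠ (S.link t).2) :
    measurement S X v t ω
      = dotProduct (measurementVector (S.link t)) (fun m => X m t ω) + v t ω := by
  unfold measurement measurementVector dotProduct
  rw [withRef_eq_sum, withRef_eq_sum, ← Finset.sum_sub_distrib]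
  congr 1
  refine Finset.sum_congr rfl fun m _ => ?_
  by_cases h1 : m.succ = (S.link t).1
  · have h2 : m.succ ≠ (S.link t).2 := fun h2 => h (h1.symm.trans h2)
    simp [h1, h]
  · simp [h1]

/-- The standing probabilistic model. `W m` are independent standard Brownian motions, `X m` is
the Ornstein-Uhlenbeck process `dX_m = -α X_m dt + ε_m dW_m`, `X_m(0) = 0`, i.e. the continuous
solution of the integral equation that this abbreviates, and `v t`, `t ∈ S.times`, is white Gaussian
noise: centred Gaussian of variance `S.variance t`, independent across time and independent of the
Brownian motions. Processes are indexed by `ℝ`; only times `t ≥ 0` are used. -/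
structure IsClockModel {n : ℕ} {E : Set (Fin (n + 1) × Fin (n + 1))} {Ω : Type*}
    [MeasurableSpace Ω] (μ : Measure Ω) (α : ℝ) (ε : Fin n → ℝ) (S : MeasurementSchedule n E)
    (W X : Fin n → ℝ → Ω → ℝ) (v : ℝ → Ω → ℝ) : Prop where
  measurable_W : ∀ m, ∀ t : ℝ, 0 ≤ t → Measurable (W m t)
  measurable_X : ∀ m, ∀ t : ℝ, 0 ≤ t → Measurable (X m t)
  measurable_v : ∀ t ∈ S.times, Measurable (v t)
  brownian : ∀ m, IsBrownianReal (fun t : ℝ≥0 => W m (t : ℝ)) μ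
  continuous_X : ∀ m, ∀ᵐ ω ∂μ, ContinuousOn (fun t : ℝ => X m t ω) (Set.Ici 0)
  sde : ∀ m, ∀ᵐ ω ∂μ, ∀ t : ℝ, 0 ≤ t →
    X m t ω = -α * (∫ s in (0 : ℝ)..t, X m s ω) + ε m * W m t ω
  noise_law : ∀ t ∈ S.times, HasLaw (v t) (gaussianReal 0 (S.variance t)) μ
  indep_W : iIndepFun (fun (m : Fin n) (ω : Ω) (t : ℝ≥0) => W m (t : ℝ) ω) μ
  indep_v : iIndepFun (fun (t : S.times) (ω : Ω) => v (t : ℝ) ω) μ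
  indep_W_v : IndepFun (fun (ω : Ω) (m : Fin n) (t : ℝ≥0) => W m (t : ℝ) ω)
    (fun (ω : Ω) (t : S.times) => v (t : ℝ) ω) μ

/-- The `σ`-algebra generated by the values `y s` over the instants `s` of a set. -/
abbrev observed {Ω : Type*} (y : ℝ → Ω → ℝ) (I : Set ℝ) : MeasurableSpace Ω :=
  ⨆ s ∈ I, MeasurableSpace.comap (y s) (borel ℝ)

/-- `Zh` is the optimal estimate of the random vector `Z` given the `σ`-algebra `𝒴`: it is the
conditional mean of `Z`, and it minimizes the mean square error among all `𝒴`-measurable square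
integrable estimates. -/
structure IsOptimalEstimate {n : ℕ} {Ω : Type*} {m₀ : MeasurableSpace Ω} (μ : Measure Ω)
    (𝒴 : MeasurableSpace Ω) (Z Zh : Ω → Fin n → ℝ) : Prop where
  le : 𝒴 ≤ m₀
  measurable : ∀ m, Measurable[𝒴] (fun ω => Zh ω m)
  memLp_state : ∀ m, MemLp (fun ω => Z ω m) 2 μ
  memLp : ∀ m, MemLp (fun ω => Zh ω m) 2 μ
  condMean : ∀ m, (fun ω => Zh ω m) =ᵐ[μ] μ[fun ω => Z ω m | 𝒴]
  minimal : ∀ U : Ω → Fin n → ℝ, (∀ m, Measurable[𝒴] (fun ω => U ω m)) →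
    (∀ m, MemLp (fun ω => U ω m) 2 μ) →
    ∫ ω, ∑ m, (Z ω m - Zh ω m) ^ 2 ∂μ ≤ ∫ ω, ∑ m, (Z ω m - U ω m) ^ 2 ∂μ

/-- Unconditional error covariance `𝔼[(Z - Zh)(Z - Zh)ᵀ]`. -/
noncomputable def errorCov {n : ℕ} {Ω : Type*} [MeasurableSpace Ω] (μ : Measure Ω)
    (Z Zh : Ω → Fin n → ℝ) : Matrix (Fin n) (Fin n) ℝ :=
  fun m l => ∫ ω, (Z ω m - Zh ω m) * (Z ω l - Zh ω l) ∂μ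

/-- Conditional error covariance `𝔼[(Z - Zh)(Z - Zh)ᵀ | 𝒴]`, entry by entry. -/
noncomputable def condErrorCov {n : ℕ} {Ω : Type*} {m₀ : MeasurableSpace Ω} (μ : Measure Ω)
    (𝒴 : MeasurableSpace Ω) (Z Zh : Ω → Fin n → ℝ) (m l : Fin n) : Ω → ℝ :=
  μ[fun ω => (Z ω m - Zh ω m) * (Z ω l - Zh ω l) | 𝒴]

/-- `x` is a solution on `[t₀, ∞)` of the system with impulses at the times `T`:
`dx/dt = f x` between impulses and `x(t⁺) = g t (x(t⁻))` at an impulse, with `x(t₀⁻) = x₀`.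
Here `x t` is the (right-continuous) value `x(t⁺)` and `xm t` is the value `x(t⁻)`. -/
structure IsImpulsiveSolution {F : Type*} [AddCommGroup F] [Module ℝ F] [TopologicalSpace F]
    [ContinuousSMul ℝ F]
    (T : Set ℝ) (f : F → F) (g : ℝ → F → F) (t₀ : ℝ) (x₀ : F) (x xm : ℝ → F) : Prop where
  init : xm t₀ = x₀
  deriv : ∀ t, t₀ < t → t ∉ T → HasDerivAt x (f (x t)) t
  right : ∀ t, t₀ ≤ t → ContinuousWithinAt x (Set.Ici t) t
  left : ∀ t, t₀ < t → Tendsto x (𝓝[<] t) (𝓝 (xm t))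
  noJump : ∀ t, t₀ ≤ t → t ∉ T → x t = xm t
  jump : ∀ t, t₀ ≤ t → t ∈ T → x t = g t (xm t)

/-- Uniform (in the initial time) global asymptotic stability of the origin for the system with
impulses, for initial times in `[0, ∞)`: uniform stability and uniform attraction. -/
def IsUniformlyAsymptoticallyStable {F : Type*} [NormedAddCommGroup F] [NormedSpace ℝ F]
    (T : Set ℝ) (f : F → F) (g : ℝ → F → F) : Prop :=
  (∀ η > 0, ∃ δ > 0, ∀ t₀ ≥ (0 : ℝ), ∀ (x₀ : F) (x xm : ℝ → F),
    IsImpulsiveSolution T f g t₀ x₀ x xm → ‖x₀‖ < δ → ∀ t ≥ t₀, ‖x t‖ < η) ∧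
  (∀ r > 0, ∀ η > 0, ∃ τ > (0 : ℝ), ∀ t₀ ≥ (0 : ℝ), ∀ (x₀ : F) (x xm : ℝ → F),
    IsImpulsiveSolution T f g t₀ x₀ x xm → ‖x₀‖ < r → ∀ t ≥ t₀ + τ, ‖x t‖ < η)

/-- The innovation variance `c = P_{ii} + P_{jj} - 2 P_{ij} + σ²`. -/
def innovationVariance {n : ℕ} (P : Matrix (Fin n) (Fin n) ℝ) (e : Fin (n + 1) × Fin (n + 1))
    (σ2 : ℝ) : ℝ :=
  withRefMatrix P e.1 e.1 + withRefMatrix P e.2 e.2 - 2 * withRefMatrix P e.1 e.2 + σ2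

/-- The gain `K_m = (P_{mj} - P_{mi}) / c`. -/
noncomputable def gain {n : ℕ} (P : Matrix (Fin n) (Fin n) ℝ) (e : Fin (n + 1) × Fin (n + 1))
    (σ2 : ℝ) (m : Fin n) : ℝ :=
  (withRefMatrix P m.succ e.2 - withRefMatrix P m.succ e.1) / innovationVariance P e σ2

/-- The estimate update `x_m + K_m (y - x_j + x_i)`. -/
noncomputable def estimateUpdate {n : ℕ} (P : Matrix (Fin n) (Fin n) ℝ)
    (e : Fin (n + 1) × Fin (n + 1)) (σ2 y : ℝ) (x : Fin n → ℝ) : Fin n → ℝ :=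
  fun m => x m + gain P e σ2 m * (y - withRef x e.2 + withRef x e.1)

/-- The rank-one covariance update
`P_{ml} - (P_{mj} - P_{mi}) (P_{jl} - P_{il}) / c`. -/
noncomputable def covarianceUpdate {n : ℕ} (e : Fin (n + 1) × Fin (n + 1)) (σ2 : ℝ)
    (P : Matrix (Fin n) (Fin n) ℝ) : Matrix (Fin n) (Fin n) ℝ :=
  fun m l => P m l -
    (withRefMatrix P m.succ e.2 - withRefMatrix P m.succ e.1) *
      (withRefMatrix P e.2 l.succ - withRefMatrix P e.1 l.succ) / innovationVariance P e σ2

/-- The continuous-discrete Kalman-Bucy filter equations driven by the measurements `y`. `Xh t`,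
`P t` are the values after, and `Xhm t`, `Pm t` the values before, a possible measurement at `t`. -/
structure IsKalmanBucyFilter {n : ℕ} {E : Set (Fin (n + 1) × Fin (n + 1))} {Ω : Type*}
    (α : ℝ) (ε : Fin n → ℝ) (S : MeasurementSchedule n E) (y : ℝ → Ω → ℝ)
    (Xh Xhm : ℝ → Ω → Fin n → ℝ) (P Pm : ℝ → Matrix (Fin n) (Fin n) ℝ) : Prop where
  estimate : ∀ ω, IsImpulsiveSolution S.times (fun x => -α • x)
    (fun t x => estimateUpdate (Pm t) (S.link t) (S.variance t) (y t ω) x)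
    0 0 (fun t => Xh t ω) (fun t => Xhm t ω)
  covariance : IsImpulsiveSolution S.times
    (fun Q => -(2 * α) • Q + (Matrix.diagonal ε) ^ 2)
    (fun t Q => covarianceUpdate (S.link t) (S.variance t) Q) 0 0 P Pm

end ClockNetwork

/-! Optimality is orthogonal projection among Gaussian variables. The states and measurements lie in
one linear space of centred Gaussians, the almost sure limits of combinations of Brownian values and
noises (`gaussianHull`). In it uncorrelated families are independent (`IsGaussianSpace.indepFun`),
so estimation is linear algebra for the covariance form. The invariant `IsLinearEstimate` says that
the estimate is a combination of the past measurements and that its error is uncorrelated with them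
and has covariance `P`. The flow preserves it because the fresh part of the Ornstein-Uhlenbeck
process is uncorrelated with the past; a jump preserves it because the gain removes exactly the
component of the error along the innovation. The error is then independent of the observations,
whence the conditional mean, the minimality and the constant conditional covariance. Error and
estimate being uncorrelated, the error variance is at most that of the state, at most `ε² / (2α)`,
which bounds `P`.

The covariances of the Ornstein-Uhlenbeck process come from a discretized variation of constants
formula: pathwise limits of Gaussians are Gaussian, and their covariances converge
(`hasLaw_gaussianReal_of_tendsto`, `IsGaussianSpace.tendsto_cov`).

Stability cannot use a uniform lower bound on `P`, for the noise variances may be arbitrarily small.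
Instead `P` is read as the resistance matrix of a passive network grounded at the reference node: a
covector `r` injects currents, `P r` are the potentials, a measurement of `(i, j)` joins the two
nodes by a resistor `σ²`, and the flow rescales the network and puts a resistor in series with each
terminal. The transposed unforced filter, apart from its factor `exp (-α (t - t₀))`, transports
currents backward through this network, without increasing the power, even the power seen through
any monotone `ψ` (`exists_power_jump_le`, `power_flow_ge`). A unit current injected at time `t` thus
arrives at `t₀` with entries of size at most `1` (`abs_le_one_of_power_le`). Hence `|x_m(t)| ≤ exp
(-α (t - t₀)) ∑ |x₀ i|`, whatever the schedule. -/

namespace ClockNetwork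

/-! ### Impulsive systems: induction over events, explicit flows, existence -/

/-- Induction along a locally finite set of instants: `A` is about the state before, `B` about the
state after a possible event. -/
theorem impulsive_induction {T : Set ℝ} (hT : ∀ t, (T ∩ Set.Iic t).Finite) {t₀ : ℝ}
    {A B : ℝ → Prop} (h0 : A t₀) (hjump : ∀ t, t₀ ≤ t → A t → B t)
    (hflow : ∀ s t, t₀ ≤ s → s < t → (∀ u ∈ Set.Ioo s t, u ∉ T) → B s → A t) :
    ∀ t, t₀ ≤ t → A t ∧ B t := by
  -- Strong induction on the number of events in `[t₀, t)`; the last of them splits off an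
  -- event-free flow.
  suffices h : ∀ k : ℕ, ∀ t, t₀ ≤ t → (T ∩ Set.Ico t₀ t).ncard = k → A t from
    fun t ht => ⟨h _ t ht rfl, hjump t ht (h _ t ht rfl)⟩
  intro k
  induction k using Nat.strong_induction_on with
  | _ k ih =>
    intro t ht hk
    rcases ht.eq_or_lt with rfl | hlt
    · exact h0
    have hfin : ∀ u, (T ∩ Set.Ico t₀ u).Finite := fun u =>
      (hT u).subset (Set.inter_subset_inter_right _ fun x hx => hx.2.le)
    rcases (T ∩ Set.Ico t₀ t).eq_empty_or_nonempty with he | hne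
    · refine hflow t₀ t le_rfl hlt (fun u hu huT => ?_) (hjump t₀ le_rfl h0)
      have : u ∈ T ∩ Set.Ico t₀ t := ⟨huT, hu.1.le, hu.2⟩
      simp [he] at this
    · obtain ⟨s, hs, hmax⟩ := Set.exists_max_image _ id (hfin t) hne
      refine hflow s t hs.2.1 hs.2.2 (fun u hu huT => ?_) (hjump s hs.2.1 ?_)
      · exact absurd (hmax u ⟨huT, hs.2.1.trans hu.1.le, hu.2⟩) (not_le.2 hu.1)
      · refine ih _ ?_ s hs.2.1 rfl
        rw [← hk]
        refine Set.ncard_lt_ncard ⟨?_, fun h => ?_⟩ (hfin t)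
        · exact fun u hu => ⟨hu.1, hu.2.1, hu.2.2.trans hs.2.2⟩
        · exact lt_irrefl _ (h hs).2.2

theorem exists_last_before {T : Set ℝ} (hT : ∀ t, (T ∩ Set.Iic t).Finite) {t₀ t : ℝ}
    (h : t₀ < t) : ∃ s, t₀ ≤ s ∧ s < t ∧ ∀ u ∈ Set.Ioo s t, u ∉ T := by
  -- The flow step already contains the claim, so the induction carries no information after a jump.
  refine (impulsive_induction (t₀ := t₀) hT
    (A := fun t => t₀ < t → ∃ s, t₀ ≤ s ∧ s < t ∧ ∀ u ∈ Set.Ioo s t, u ∉ T)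
    (B := fun _ => True) (fun h => absurd h (lt_irrefl _)) (fun _ _ _ => trivial) ?_ t h.le).1 h
  exact fun s t hs hst hu _ _ => ⟨s, hs, hst, hu⟩

theorem exists_isolating_radius {T : Set ℝ} (hT : ∀ t, (T ∩ Set.Iic t).Finite) (t : ℝ) :
    ∃ δ > 0, ∀ u, |u - t| < δ → u ≠ t → u ∉ T := by
  have hc : ((T ∩ Set.Iic (t + 1)) \ {t})ᶜ ∈ 𝓝 t :=
    ((hT (t + 1)).sdiff).isClosed.isOpen_compl.mem_nhds (by simp)
  obtain ⟨δ, hδ, hball⟩ := Metric.mem_nhds_iff.1 hc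
  refine ⟨min δ 1, by positivity, fun u hu hne huT => ?_⟩
  have h1 : u ∈ Metric.ball t δ := by
    rw [Metric.mem_ball, Real.dist_eq]; exact hu.trans_le (min_le_left _ _)
  refine hball h1 ⟨⟨huT, ?_⟩, hne⟩
  have := (abs_lt.1 (hu.trans_le (min_le_right _ _))).2
  simp only [Set.mem_Iic]; linarith

/-- The solution of `f' = -a f + b` on an interval, with one-sided limits at its ends. -/
theorem linear_flow_eq {a b s t : ℝ} {f : ℝ → ℝ} {l : ℝ} (ha : a ≠ 0) (hst : s < t)
    (hd : ∀ u ∈ Set.Ioo s t, HasDerivAt f (-a * f u + b) u)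
    (hr : ContinuousWithinAt f (Set.Ici s) s) (hl : Tendsto f (𝓝[<] t) (𝓝 l)) :
    l = Real.exp (-a * (t - s)) * f s + b * (1 - Real.exp (-a * (t - s))) / a := by
  -- Integrating factor: `g` is constant inside the interval. The equation is known only there, so
  -- the endpoint values enter through one-sided limits.
  set g : ℝ → ℝ := fun u => Real.exp (a * u) * (f u - b / a) with hg
  have hgd : ∀ u ∈ Set.Ioo s t, HasDerivAt g 0 u := by
    intro u hu
    have h1 : HasDerivAt (fun u => Real.exp (a * u)) (Real.exp (a * u) * (a * 1)) u :=
      ((hasDerivAt_id u).const_mul a).exp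
    have h2 := h1.mul ((hd u hu).sub_const (b / a))
    refine h2.congr_deriv ?_
    field_simp
    ring
  have hconst : ∀ u ∈ Set.Ioo s t, ∀ v ∈ Set.Ioo s t, g u = g v := fun u hu v hv =>
    isOpen_Ioo.is_const_of_deriv_eq_zero isPreconnected_Ioo
      (fun w hw => (hgd w hw).differentiableAt.differentiableWithinAt)
      (fun w hw => (hgd w hw).deriv) hu hv
  set p := (s + t) / 2
  have hp : p ∈ Set.Ioo s t := ⟨by simp only [p]; linarith, by simp only [p]; linarith⟩
  have hs : g s = g p := by
    have h1 : Tendsto g (𝓝[>] s) (𝓝 (g s)) := by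
      have h2 : ContinuousWithinAt g (Set.Ici s) s :=
        (by fun_prop : Continuous fun u => Real.exp (a * u)).continuousWithinAt.mul
          (hr.sub continuousWithinAt_const)
      exact h2.mono Set.Ioi_subset_Ici_self
    refine tendsto_nhds_unique h1 (tendsto_const_nhds.congr' ?_)
    filter_upwards [Ioo_mem_nhdsGT hst] with u hu using hconst p hp u hu
  have ht : Real.exp (a * t) * (l - b / a) = g p := by
    have h1 : Tendsto g (𝓝[<] t) (𝓝 (Real.exp (a * t) * (l - b / a))) :=
      (((by fun_prop : Continuous fun u => Real.exp (a * u)).tendsto t).mono_left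
        nhdsWithin_le_nhds).mul (hl.sub tendsto_const_nhds)
    refine tendsto_nhds_unique h1 (tendsto_const_nhds.congr' ?_)
    filter_upwards [Ioo_mem_nhdsLT hst] with u hu using hconst p hp u hu
  have h3 : Real.exp (a * t) * (l - b / a) = Real.exp (a * s) * (f s - b / a) := by
    rw [ht, ← hs]
  have h4 : Real.exp (-a * (t - s)) = Real.exp (a * s) / Real.exp (a * t) := by
    rw [← Real.exp_sub]; ring_nf
  have h5 := Real.exp_pos (a * t)
  rw [h4]
  field_simp
  field_simp at h3
  linarith

namespace IsImpulsiveSolution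

theorem restrict {F : Type*} [AddCommGroup F] [Module ℝ F] [TopologicalSpace F]
    [ContinuousSMul ℝ F] {T : Set ℝ} {f : F → F} {g : ℝ → F → F} {t₀ t₁ : ℝ} {x₀ : F}
    {x xm : ℝ → F} (h : IsImpulsiveSolution T f g t₀ x₀ x xm) (h01 : t₀ ≤ t₁) :
    IsImpulsiveSolution T f g t₁ (xm t₁) x xm where
  init := rfl
  deriv t ht := h.deriv t (h01.trans_lt ht)
  right t ht := h.right t (h01.trans ht)
  left t ht := h.left t (h01.trans_lt ht)
  noJump t ht := h.noJump t (h01.trans ht)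
  jump t ht := h.jump t (h01.trans ht)

theorem decay_flow {n : ℕ} {T : Set ℝ} {α : ℝ} (hα : α ≠ 0)
    {g : ℝ → (Fin n → ℝ) → (Fin n → ℝ)} {t₀ : ℝ} {x₀ : Fin n → ℝ} {x xm : ℝ → Fin n → ℝ}
    (h : IsImpulsiveSolution T (fun x => -α • x) g t₀ x₀ x xm) {s t : ℝ} (hs : t₀ ≤ s)
    (hst : s < t) (hT : ∀ u ∈ Set.Ioo s t, u ∉ T) (m : Fin n) :
    xm t m = Real.exp (-α * (t - s)) * x s m := by
  have := linear_flow_eq (f := fun u => x u m) (b := 0) (l := xm t m) hα hst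
    (fun u hu => ?_) ?_ ?_
  · simpa using this
  · have := hasDerivAt_pi.1 (h.deriv u (hs.trans_lt hu.1) (hT u hu)) m
    simpa using this
  · exact ((continuous_apply m).continuousAt).comp_continuousWithinAt (h.right s hs)
  · exact ((continuous_apply m).tendsto _).comp (h.left t (hs.trans_lt hst))

theorem covariance_flow {n : ℕ} {T : Set ℝ} {α : ℝ} (hα : α ≠ 0) {ε : Fin n → ℝ}
    {g : ℝ → Matrix (Fin n) (Fin n) ℝ → Matrix (Fin n) (Fin n) ℝ} {t₀ : ℝ}
    {P₀ : Matrix (Fin n) (Fin n) ℝ} {P Pm : ℝ → Matrix (Fin n) (Fin n) ℝ}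
    (h : IsImpulsiveSolution T (fun Q => -(2 * α) • Q + (Matrix.diagonal ε) ^ 2) g t₀ P₀ P Pm)
    {s t : ℝ} (hs : t₀ ≤ s) (hst : s < t) (hT : ∀ u ∈ Set.Ioo s t, u ∉ T) (m l : Fin n) :
    Pm t m l = Real.exp (-(2 * α) * (t - s)) * P s m l
      + (if m = l then ε m ^ 2 else 0) * (1 - Real.exp (-(2 * α) * (t - s))) / (2 * α) := by
  refine linear_flow_eq (f := fun u => P u m l) (l := Pm t m l) (by positivity) hst
    (fun u hu => ?_) ?_ ?_
  · have h1 : HasDerivAt (F := Fin n → Fin n → ℝ) P _ u :=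
      h.deriv u (hs.trans_lt hu.1) (hT u hu)
    have := hasDerivAt_pi.1 (hasDerivAt_pi.1 h1 m) l
    refine this.congr_deriv ?_
    simp [Matrix.diagonal_pow, Matrix.diagonal_apply]
  · have : Continuous fun Q : Matrix (Fin n) (Fin n) ℝ => Q m l := by fun_prop
    exact this.continuousAt.comp_continuousWithinAt (h.right s hs)
  · have : Continuous fun Q : Matrix (Fin n) (Fin n) ℝ => Q m l := by fun_prop
    exact (this.tendsto _).comp (h.left t (hs.trans_lt hst))

end IsImpulsiveSolution

/-- The state just before `t` of the impulsive system with flow `φ`, jumps `g` at the instants `A`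
and initial state `x₀` at time `0`. -/
noncomputable def impulsiveState {F : Type*} (φ : ℝ → F → F) (g : ℝ → F → F) (x₀ : F)
    (A : Finset ℝ) (t : ℝ) : F :=
  if h : A.Nonempty then
    φ (t - A.max' h) (g (A.max' h) (impulsiveState φ g x₀ (A.erase (A.max' h)) (A.max' h)))
  else φ t x₀
termination_by A.card
decreasing_by exact Finset.card_erase_lt_of_mem (A.max'_mem h)

/-- For a frozen set of events the state is a single flow line, so continuity and differentiability
in `t` come from `φ`. -/
theorem impulsiveState_eq_flow {F : Type*} (φ : ℝ → F → F) (g : ℝ → F → F) (x₀ : F)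
    (A : Finset ℝ) : ∃ s z, ∀ t, impulsiveState φ g x₀ A t = φ (t - s) z := by
  by_cases h : A.Nonempty
  · exact ⟨_, _, fun t => by rw [impulsiveState, dif_pos h]⟩
  · exact ⟨0, x₀, fun t => by rw [impulsiveState, dif_neg h, sub_zero]⟩

theorem impulsiveState_insert {F : Type*} (φ : ℝ → F → F) (g : ℝ → F → F) (x₀ : F)
    (A : Finset ℝ) {s : ℝ} (hs : ∀ u ∈ A, u < s) (t : ℝ) :
    impulsiveState φ g x₀ (insert s A) t = φ (t - s) (g s (impulsiveState φ g x₀ A s)) := by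
  have h : (insert s A).Nonempty := Finset.insert_nonempty _ _
  have hmax : (insert s A).max' h = s := by
    refine le_antisymm (Finset.max'_le _ _ _ fun u hu => ?_)
      (Finset.le_max' _ _ (Finset.mem_insert_self _ _))
    rcases Finset.mem_insert.1 hu with rfl | hu
    · exact le_rfl
    · exact (hs u hu).le
  have hnot : s ∉ A := fun h => lt_irrefl _ (hs s h)
  rw [impulsiveState, dif_pos h]
  simp only [hmax, Finset.erase_insert hnot]

theorem exists_isImpulsiveSolution {F : Type*} [NormedAddCommGroup F] [NormedSpace ℝ F] {T : Set ℝ} (hT : ∀ t, (T ∩ Set.Iic t).Finite)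
    (hT0 : ∀ t ∈ T, 0 ≤ t) {f : F → F} (g : ℝ → F → F) (x₀ : F) (φ : ℝ → F → F)
    (h0 : ∀ x, φ 0 x = x) (hc : ∀ x, Continuous fun u => φ u x)
    (hd : ∀ x s t, HasDerivAt (fun u => φ (u - s) x) (f (φ (t - s) x)) t) :
    ∃ x xm, IsImpulsiveSolution T f g 0 x₀ x xm := by
  classical
  have hfin : ∀ t, (T ∩ Set.Iio t).Finite := fun t =>
    (hT t).subset (Set.inter_subset_inter_right _ Set.Iio_subset_Iic_self)
  set A : ℝ → Finset ℝ := fun t => (hfin t).toFinset with hA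
  -- Only events strictly before `t` count, which makes `xm` the value before a jump at `t`.
  have hAmem : ∀ t u, u ∈ A t ↔ u ∈ T ∧ u < t := fun t u => by simp [hA]
  set xm : ℝ → F := fun t => impulsiveState φ g x₀ (A t) t with hxm
  set x : ℝ → F := fun t => if t ∈ T then g t (xm t) else xm t with hx
  have hcA : ∀ B, Continuous (impulsiveState φ g x₀ B) := by
    intro B
    obtain ⟨s, z, h⟩ := impulsiveState_eq_flow φ g x₀ B
    rw [show impulsiveState φ g x₀ B = fun t => φ (t - s) z from funext h]
    exact (hc z).comp (by fun_prop)
  have hdA : ∀ B t, HasDerivAt (impulsiveState φ g x₀ B) (f (impulsiveState φ g x₀ B t)) t := by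
    intro B t
    obtain ⟨s, z, h⟩ := impulsiveState_eq_flow φ g x₀ B
    rw [show impulsiveState φ g x₀ B = fun t => φ (t - s) z from funext h]
    exact hd z s t
  -- Near `t` the set of past events is locally constant on either side, so `x` can be compared with
  -- the state for a frozen set.
  have hleft : ∀ t, ∃ δ > 0, ∀ u, t - δ < u → u < t →
      x u = impulsiveState φ g x₀ (A t) u := by
    intro t
    obtain ⟨δ, hδ, h⟩ := exists_isolating_radius hT t
    refine ⟨δ, hδ, fun u hu hut => ?_⟩
    have huT : u ∉ T := h u (by rw [abs_lt]; constructor <;> linarith) hut.ne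
    have hAu : A u = A t := by
      ext w
      rw [hAmem, hAmem]
      refine ⟨fun hw => ⟨hw.1, hw.2.trans hut⟩, fun hw => ⟨hw.1, ?_⟩⟩
      by_contra hwu
      exact h w (by rw [abs_lt]; constructor <;> linarith [hw.2]) hw.2.ne hw.1
    simp only [hx, if_neg huT, hxm, hAu]
  have hright : ∀ t, ∃ δ > 0, ∀ u, t < u → u < t + δ →
      u ∉ T ∧ A u = if t ∈ T then insert t (A t) else A t := by
    intro t
    obtain ⟨δ, hδ, h⟩ := exists_isolating_radius hT t
    refine ⟨δ, hδ, fun u hu hut => ⟨h u (by rw [abs_lt]; constructor <;> linarith) hu.ne', ?_⟩⟩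
    have key : ∀ w, w ∈ A u ↔ w ∈ T ∧ w ≤ t := by
      intro w
      rw [hAmem]
      refine ⟨fun hw => ⟨hw.1, ?_⟩, fun hw => ⟨hw.1, hw.2.trans_lt hu⟩⟩
      by_contra hwt
      exact h w (by rw [abs_lt]; constructor <;> linarith [hw.2]) (fun he => hwt he.le) hw.1
    ext w
    rw [key]
    split_ifs with htT
    · rw [Finset.mem_insert, hAmem, le_iff_eq_or_lt]
      constructor
      · rintro ⟨h1, h2 | h2⟩
        · exact Or.inl h2
        · exact Or.inr ⟨h1, h2⟩
      · rintro (rfl | h2)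
        · exact ⟨htT, Or.inl rfl⟩
        · exact ⟨h2.1, Or.inr h2.2⟩
    · rw [hAmem]
      refine and_congr_right fun hw => ⟨fun h => lt_of_le_of_ne h ?_, fun h => h.le⟩
      rintro rfl
      exact htT hw
  refine ⟨x, xm, ?_, ?_, ?_, ?_, ?_, ?_⟩
  · have : A 0 = ∅ := by
      ext w
      rw [hAmem]
      simpa using fun hw => hT0 w hw
    simp only [hxm, this]
    rw [impulsiveState, dif_neg (by simp), h0]
  · intro t _ htT
    have hxt : x t = impulsiveState φ g x₀ (A t) t := by simp only [hx, if_neg htT, hxm]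
    have heq : x =ᶠ[𝓝 t] impulsiveState φ g x₀ (A t) := by
      obtain ⟨δ, hδ, h⟩ := hleft t
      obtain ⟨δ', hδ', h'⟩ := hright t
      filter_upwards [Ioo_mem_nhds (show t - δ < t by linarith) (show t < t + δ' by linarith)]
        with u hu
      rcases lt_trichotomy u t with hlt | rfl | hgt
      · exact h u hu.1 hlt
      · exact hxt
      · obtain ⟨h1, h2⟩ := h' u hgt hu.2
        simp only [hx, if_neg h1, hxm, h2, if_neg htT]
    rw [hxt]
    exact (hdA (A t) t).congr_of_eventuallyEq heq
  · intro t _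
    obtain ⟨δ', hδ', h'⟩ := hright t
    have hnear : Set.Ico t (t + δ') ∈ 𝓝[≥] t := Ico_mem_nhdsGE (by linarith)
    by_cases htT : t ∈ T
    · have heq : x =ᶠ[𝓝[≥] t] fun u => φ (u - t) (x t) := by
        filter_upwards [hnear] with u hu
        rcases hu.1.eq_or_lt with rfl | hgt
        · simp [h0]
        · obtain ⟨h1, h2⟩ := h' u hgt hu.2
          rw [if_pos htT] at h2
          simp only [hx, if_neg h1, hxm, h2, if_pos htT]
          exact impulsiveState_insert φ g x₀ (A t) (fun w hw => ((hAmem _ _).1 hw).2) u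
      refine ContinuousWithinAt.congr_of_eventuallyEq ?_ heq (by simp [h0])
      exact ((hc (x t)).comp (by fun_prop : Continuous fun u : ℝ => u - t)).continuousWithinAt
    · have heq : x =ᶠ[𝓝[≥] t] impulsiveState φ g x₀ (A t) := by
        filter_upwards [hnear] with u hu
        rcases hu.1.eq_or_lt with rfl | hgt
        · simp only [hx, if_neg htT, hxm]
        · obtain ⟨h1, h2⟩ := h' u hgt hu.2
          simp only [hx, if_neg h1, hxm, h2, if_neg htT]
      refine (hcA (A t)).continuousWithinAt.congr_of_eventuallyEq heq ?_
      simp only [hx, if_neg htT, hxm]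
  · intro t _
    obtain ⟨δ, hδ, h⟩ := hleft t
    have heq : x =ᶠ[𝓝[<] t] impulsiveState φ g x₀ (A t) := by
      filter_upwards [Ioo_mem_nhdsLT (show t - δ < t by linarith)] with u hu
      exact h u hu.1 hu.2
    exact (((hcA (A t)).tendsto t).mono_left nhdsWithin_le_nhds).congr' heq.symm
  · intro t _ htT
    simp only [hx, if_neg htT]
  · intro t _ htT
    simp only [hx, if_pos htT]

theorem exists_kalmanBucyFilter {n : ℕ} {E : Set (Fin (n + 1) × Fin (n + 1))} {Ω : Type*}
    {α : ℝ} (hα : α ≠ 0) (ε : Fin n → ℝ) (S : MeasurementSchedule n E) (y : ℝ → Ω → ℝ) :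
    ∃ (Xh Xhm : ℝ → Ω → Fin n → ℝ) (P Pm : ℝ → Matrix (Fin n) (Fin n) ℝ),
      IsKalmanBucyFilter α ε S y Xh Xhm P Pm := by
  -- The covariance does not depend on the data; it is solved first and then supplies the gains for
  -- every `ω`.
  obtain ⟨P, Pm, hP⟩ : ∃ P Pm, IsImpulsiveSolution S.times
      (fun Q : Matrix (Fin n) (Fin n) ℝ => -(2 * α) • Q + (Matrix.diagonal ε) ^ 2)
      (fun t Q => covarianceUpdate (S.link t) (S.variance t) Q) 0 0 P Pm := by
    refine exists_isImpulsiveSolution (F := Fin n → Fin n → ℝ) S.locallyFinite S.nonneg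
      (f := fun Q : Matrix (Fin n) (Fin n) ℝ => -(2 * α) • Q + (Matrix.diagonal ε) ^ 2)
      (fun t Q => covarianceUpdate (S.link t) (S.variance t) Q) 0
      (fun u Q m l => Real.exp (-(2 * α) * u) * Q m l
        + (Matrix.diagonal ε ^ 2) m l * (1 - Real.exp (-(2 * α) * u)) / (2 * α)) ?_ ?_ ?_
    · intro Q
      funext m l
      simp
    · intro Q
      fun_prop
    · intro Q s t
      refine hasDerivAt_pi.2 fun m => hasDerivAt_pi.2 fun l => ?_
      have h1 : HasDerivAt (fun u : ℝ => Real.exp (-(2 * α) * (u - s)))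
          (Real.exp (-(2 * α) * (t - s)) * (-(2 * α) * 1)) t :=
        (((hasDerivAt_id t).sub_const s).const_mul (-(2 * α))).exp
      have h2 := (h1.mul_const (Q m l)).add
        (((h1.const_sub 1).const_mul ((Matrix.diagonal ε ^ 2) m l)).div_const (2 * α))
      refine h2.congr_deriv ?_
      change _ = -(2 * α) * (Real.exp (-(2 * α) * (t - s)) * Q m l
        + (Matrix.diagonal ε ^ 2) m l * (1 - Real.exp (-(2 * α) * (t - s))) / (2 * α))
        + (Matrix.diagonal ε ^ 2) m l
      field_simp
      ring
  have hx : ∀ ω, ∃ x xm, IsImpulsiveSolution S.times (fun x : Fin n → ℝ => -α • x)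
      (fun t x => estimateUpdate (Pm t) (S.link t) (S.variance t) (y t ω) x) 0 0 x xm := by
    intro ω
    refine exists_isImpulsiveSolution S.locallyFinite S.nonneg _ _
      (fun u x => Real.exp (-α * u) • x) ?_ ?_ ?_
    · intro x
      simp
    · intro x
      fun_prop
    · intro x s t
      have h1 : HasDerivAt (fun u : ℝ => Real.exp (-α * (u - s)))
          (Real.exp (-α * (t - s)) * (-α * 1)) t :=
        (((hasDerivAt_id t).sub_const s).const_mul (-α)).exp
      refine (h1.smul_const x).congr_deriv ?_
      rw [smul_smul]
      ring_nf
  choose x xm h using hx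
  exact ⟨fun t ω => x ω t, fun t ω => xm ω t, P, Pm, ⟨h, hP⟩⟩

/-! ### The covariance as the resistance matrix of a passive network -/

section Algebra

variable {n : ℕ}

theorem measurementVector_dotProduct {e : Fin (n + 1) × Fin (n + 1)} (h : e.1 ≠ e.2)
    (x : Fin n → ℝ) : measurementVector e ⬝ᵥ x = withRef x e.2 - withRef x e.1 := by
  unfold measurementVector dotProduct
  rw [withRef_eq_sum, withRef_eq_sum, ← Finset.sum_sub_distrib]
  refine Finset.sum_congr rfl fun m _ => ?_
  by_cases h1 : m.succ = e.1
  · simp [h1, h]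
  · simp [h1]

/-- Subtracting `ψ 0` keeps the reference node at potential `0`, so a link to it is treated like any
other. -/
theorem withRef_comp (x : Fin n → ℝ) (ψ : ℝ → ℝ) (a : Fin (n + 1)) :
    withRef (fun m => ψ (x m) - ψ 0) a = ψ (withRef x a) - ψ 0 := by
  refine Fin.cases ?_ (fun i => ?_) a <;> simp [withRef]

theorem withRef_sub (x y : Fin n → ℝ) (a : Fin (n + 1)) :
    withRef (fun m => x m - y m) a = withRef x a - withRef y a := by
  refine Fin.cases ?_ (fun i => ?_) a <;> simp [withRef]

theorem withRefMatrix_symm {P : Matrix (Fin n) (Fin n) ℝ} (hP : ∀ m l, P m l = P l m)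
    (a b : Fin (n + 1)) : withRefMatrix P a b = withRefMatrix P b a := by
  refine Fin.cases ?_ (fun i => ?_) a <;> refine Fin.cases ?_ (fun j => ?_) b <;>
    simp [withRefMatrix, withRef, hP]

/-- The vector `P M` of covariances of the state with the measured difference. -/
def linkCov (P : Matrix (Fin n) (Fin n) ℝ) (e : Fin (n + 1) × Fin (n + 1)) : Fin n → ℝ :=
  fun m => measurementVector e ⬝ᵥ P m

theorem linkCov_eq {e : Fin (n + 1) × Fin (n + 1)} (h : e.1 ≠ e.2)
    (P : Matrix (Fin n) (Fin n) ℝ) (m : Fin n) :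
    linkCov P e m = withRefMatrix P m.succ e.2 - withRefMatrix P m.succ e.1 :=
  measurementVector_dotProduct h _

theorem innovationVariance_eq {e : Fin (n + 1) × Fin (n + 1)} (h : e.1 ≠ e.2)
    {P : Matrix (Fin n) (Fin n) ℝ} (hP : ∀ m l, P m l = P l m) (σ2 : ℝ) :
    innovationVariance P e σ2 = measurementVector e ⬝ᵥ linkCov P e + σ2 := by
  rw [measurementVector_dotProduct h]
  have h1 : ∀ b, withRef (linkCov P e) b = withRefMatrix P b e.2 - withRefMatrix P b e.1 := by
    intro b
    rw [show linkCov P e = fun m => withRefMatrix P m.succ e.2 - withRefMatrix P m.succ e.1 from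
      funext (linkCov_eq h P), withRef_sub]
    rfl
  rw [h1, h1, innovationVariance, withRefMatrix_symm hP e.2 e.1]
  ring

theorem gain_eq {e : Fin (n + 1) × Fin (n + 1)} (h : e.1 ≠ e.2)
    (P : Matrix (Fin n) (Fin n) ℝ) (σ2 : ℝ) (m : Fin n) :
    gain P e σ2 m = linkCov P e m / innovationVariance P e σ2 := by
  rw [gain, linkCov_eq h]

theorem covarianceUpdate_eq {e : Fin (n + 1) × Fin (n + 1)} (h : e.1 ≠ e.2)
    {P : Matrix (Fin n) (Fin n) ℝ} (hP : ∀ m l, P m l = P l m) (σ2 : ℝ) (m l : Fin n) :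
    covarianceUpdate e σ2 P m l
      = P m l - linkCov P e m * linkCov P e l / innovationVariance P e σ2 := by
  rw [covarianceUpdate, linkCov_eq h, linkCov_eq h, withRefMatrix_symm hP e.2,
    withRefMatrix_symm hP e.1]

theorem estimateUpdate_eq {e : Fin (n + 1) × Fin (n + 1)} (h : e.1 ≠ e.2)
    (P : Matrix (Fin n) (Fin n) ℝ) (σ2 y : ℝ) (x : Fin n → ℝ) (m : Fin n) :
    estimateUpdate P e σ2 y x m
      = x m + linkCov P e m / innovationVariance P e σ2 * (y - measurementVector e ⬝ᵥ x) := by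
  rw [estimateUpdate, gain_eq h, measurementVector_dotProduct h]
  ring

theorem linkCov_dotProduct (P : Matrix (Fin n) (Fin n) ℝ) (hP : ∀ m l, P m l = P l m)
    (e : Fin (n + 1) × Fin (n + 1)) (r : Fin n → ℝ) :
    linkCov P e ⬝ᵥ r = measurementVector e ⬝ᵥ (P.mulVec r) := by
  simp only [linkCov, dotProduct, Matrix.mulVec, Finset.sum_mul, Finset.mul_sum]
  rw [Finset.sum_comm]
  refine Finset.sum_congr rfl fun i _ => Finset.sum_congr rfl fun j _ => ?_
  rw [hP j i]
  ring

/-- The power that the injected currents `r` deliver to the potentials `P r` seen through `ψ`. -/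
def power (P : Matrix (Fin n) (Fin n) ℝ) (r : Fin n → ℝ) (ψ : ℝ → ℝ) : ℝ :=
  ∑ m, r m * (ψ (P.mulVec r m) - ψ 0)

theorem power_id (P : Matrix (Fin n) (Fin n) ℝ) (r : Fin n → ℝ) :
    power P r id = r ⬝ᵥ P.mulVec r := by
  simp [power, dotProduct]

theorem innovationVariance_pos {e : Fin (n + 1) × Fin (n + 1)} (h : e.1 ≠ e.2)
    {P : Matrix (Fin n) (Fin n) ℝ} (hP : ∀ m l, P m l = P l m)
    (hpsd : ∀ r, 0 ≤ r ⬝ᵥ P.mulVec r) {σ2 : ℝ} (hσ : 0 < σ2) : 0 < innovationVariance P e σ2 := by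
  rw [innovationVariance_eq h hP]
  have := hpsd (measurementVector e)
  rw [← linkCov_dotProduct P hP, dotProduct_comm] at this
  linarith

/-- The vector `r'` is the transposed update applied to `r`. It arises by letting the current `ρ`
flow through the link, and it sees the same potentials in `P` as `r` does in the updated matrix. The
two powers differ by what the link resistor absorbs. This is nonnegative for every monotone `ψ`,
since current flows from high to low potential. -/
theorem exists_power_jump_le {e : Fin (n + 1) × Fin (n + 1)} (h : e.1 ≠ e.2)
    {P : Matrix (Fin n) (Fin n) ℝ} (hP : ∀ m l, P m l = P l m)
    (hpsd : ∀ r, 0 ≤ r ⬝ᵥ P.mulVec r) {σ2 : ℝ} (hσ : 0 < σ2) (r : Fin n → ℝ) :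
    ∃ r' : Fin n → ℝ, (∀ x, r ⬝ᵥ estimateUpdate P e σ2 0 x = r' ⬝ᵥ x) ∧
      ∀ ψ : ℝ → ℝ, Monotone ψ → power P r' ψ ≤ power (covarianceUpdate e σ2 P) r ψ := by
  have hc := innovationVariance_pos h hP hpsd hσ
  have hceq := innovationVariance_eq h hP σ2
  set c := innovationVariance P e σ2 with hcdef
  set a : Fin n → ℝ := measurementVector e with ha
  set ρ := linkCov P e ⬝ᵥ r / c with hρ
  refine ⟨fun m => r m - ρ * a m, fun x => ?_, fun ψ hψ => ?_⟩
  · have h1 : ∀ m, r m * estimateUpdate P e σ2 0 x m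
        = r m * x m - linkCov P e m * r m * (a ⬝ᵥ x / c) := by
      intro m
      rw [estimateUpdate_eq h]
      ring
    have h2 : ∀ m, (r m - ρ * a m) * x m = r m * x m - ρ * (a m * x m) := fun m => by ring
    simp only [dotProduct] at h1 h2 ⊢
    simp only [h1, h2, Finset.sum_sub_distrib, ← Finset.mul_sum, ← Finset.sum_mul]
    simp only [hρ, dotProduct]
    ring
  · set w : Fin n → ℝ := P.mulVec fun m => r m - ρ * a m with hw
    have hPa : ∀ m, P.mulVec a m = linkCov P e m := fun m => by
      rw [linkCov, dotProduct_comm]; rfl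
    have hw1 : ∀ m, w m = P.mulVec r m - ρ * linkCov P e m := by
      intro m
      rw [← hPa]
      simp only [hw, Matrix.mulVec, dotProduct, Finset.mul_sum, ← Finset.sum_sub_distrib]
      exact Finset.sum_congr rfl fun i _ => by ring
    -- The new network under `r` and the old one under `r'` have equal potentials.
    have hw2 : ∀ m, (covarianceUpdate e σ2 P).mulVec r m = w m := by
      intro m
      rw [hw1]
      simp only [Matrix.mulVec, dotProduct, hρ, Finset.sum_div, Finset.sum_mul,
        ← Finset.sum_sub_distrib]
      refine Finset.sum_congr rfl fun i _ => ?_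
      rw [covarianceUpdate_eq h hP]
      ring
    -- Ohm's law on the link with resistance `σ2`: it forces `ρ` to have the sign of the potential
    -- difference.
    have haw : a ⬝ᵥ w = ρ * σ2 := by
      have h1 : a ⬝ᵥ w = a ⬝ᵥ P.mulVec r - ρ * (a ⬝ᵥ linkCov P e) := by
        simp only [dotProduct, hw1, Finset.mul_sum, ← Finset.sum_sub_distrib]
        exact Finset.sum_congr rfl fun i _ => by ring
      have h2 : a ⬝ᵥ P.mulVec r = ρ * c := by
        rw [← linkCov_dotProduct P hP, hρ, div_mul_cancel₀ _ hc.ne']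
      rw [h1, h2, hceq]
      ring
    have key : power P (fun m => r m - ρ * a m) ψ
        = power (covarianceUpdate e σ2 P) r ψ - ρ * (a ⬝ᵥ fun m => ψ (w m) - ψ 0) := by
      simp only [power, hw2, ← hw, dotProduct, Finset.mul_sum, ← Finset.sum_sub_distrib]
      exact Finset.sum_congr rfl fun i _ => by ring
    rw [key, measurementVector_dotProduct h, withRef_comp, withRef_comp]
    rw [measurementVector_dotProduct h] at haw
    have : 0 ≤ ρ * (ψ (withRef w e.2) - ψ 0 - (ψ (withRef w e.1) - ψ 0)) := by
      rcases le_total (withRef w e.1) (withRef w e.2) with hle | hle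
      · have hρ0 : 0 ≤ ρ := by
          by_contra hneg
          nlinarith [mul_pos_of_neg_of_neg (not_le.1 hneg) (neg_lt_zero.2 hσ)]
        have := hψ hle
        exact mul_nonneg hρ0 (by linarith)
      · have hρ0 : ρ ≤ 0 := by
          by_contra hneg
          nlinarith [mul_pos (not_le.1 hneg) hσ]
        have := hψ hle
        exact mul_nonneg_of_nonpos_of_nonpos hρ0 (by linarith)
    linarith

/-- The second sum is the power absorbed by resistors `d m` in series with the terminals. -/
theorem power_flow {P Q : Matrix (Fin n) (Fin n) ℝ} {κ : ℝ} {d : Fin n → ℝ}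
    (hQ : ∀ m l, Q m l = κ * P m l + if m = l then d m else 0) (r : Fin n → ℝ) (ψ : ℝ → ℝ) :
    power Q r ψ = power P r (fun z => ψ (κ * z))
      + ∑ m, r m * (ψ (κ * P.mulVec r m + d m * r m) - ψ (κ * P.mulVec r m)) := by
  have h1 : ∀ m, Q.mulVec r m = κ * P.mulVec r m + d m * r m := by
    intro m
    simp [Matrix.mulVec, dotProduct, hQ, add_mul, Finset.sum_add_distrib, Finset.mul_sum,
      mul_assoc]
  simp only [power, h1, mul_zero, ← Finset.sum_add_distrib]
  exact Finset.sum_congr rfl fun i _ => by ring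

theorem mul_monotone_increment_nonneg {ψ : ℝ → ℝ} (hψ : Monotone ψ) {d : ℝ} (hd : 0 ≤ d)
    (r w : ℝ) : 0 ≤ r * (ψ (w + d * r) - ψ w) := by
  rcases le_total 0 r with hr | hr
  · exact mul_nonneg hr (sub_nonneg.2 (hψ (by nlinarith)))
  · exact mul_nonneg_of_nonpos_of_nonpos hr (sub_nonpos.2 (hψ (by nlinarith)))

theorem power_flow_ge {P Q : Matrix (Fin n) (Fin n) ℝ} {κ : ℝ} {d : Fin n → ℝ}
    (hd : ∀ m, 0 ≤ d m)
    (hQ : ∀ m l, Q m l = κ * P m l + if m = l then d m else 0) (r : Fin n → ℝ) {ψ : ℝ → ℝ}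
    (hψ : Monotone ψ) : power P r (fun z => ψ (κ * z)) ≤ power Q r ψ := by
  rw [power_flow hQ]
  exact le_add_of_nonneg_right
    (Finset.sum_nonneg fun m _ => mul_monotone_increment_nonneg hψ (hd m) _ _)

/-- A unit current delivers at most the height of a voltage window; a current that crosses a
window of its own making is therefore at most `1`. -/
theorem abs_le_one_of_power_le {P Q : Matrix (Fin n) (Fin n) ℝ} {κ : ℝ} {d : Fin n → ℝ}
    (hd : ∀ m, 0 < d m)
    (hQ : ∀ m l, Q m l = κ * P m l + if m = l then d m else 0)
    (hP : ∀ (r : Fin n → ℝ) (ψ : ℝ → ℝ), Monotone ψ → 0 ≤ power P r ψ) (hκ : 0 ≤ κ)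
    (r : Fin n → ℝ)
    (hr : ∀ (ψ : ℝ → ℝ) (h : ℝ), Monotone ψ → (∀ u v, ψ u - ψ v ≤ h) → power Q r ψ ≤ h)
    (m : Fin n) : |r m| ≤ 1 := by
  set w := κ * P.mulVec r m
  set w' := w + d m * r m with hw'
  -- The window is the voltage drop of current `r m` across its own resistor, so that `ψ` is the
  -- clamp to the interval between `w` and `w'`. That resistor alone absorbs `d m * |r m| ^ 2`,
  -- while the window has height `d m * |r m|`.
  set ψ : ℝ → ℝ := fun z => max (min w w') (min (max w w') z) with hψ
  have hmono : Monotone ψ := fun u v huv => max_le_max le_rfl (min_le_min le_rfl huv)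
  have hwd : max w w' - min w w' = d m * |r m| := by
    rw [max_sub_min_eq_abs, hw', add_sub_cancel_left, abs_mul, abs_of_pos (hd m)]
  have hwin : ∀ u v, ψ u - ψ v ≤ d m * |r m| := by
    intro u v
    have h1 : ψ u ≤ max w w' := max_le (min_le_max) (min_le_left _ _)
    have h2 : min w w' ≤ ψ v := le_max_left _ _
    linarith
  have h1 := hr ψ _ hmono hwin
  rw [power_flow hQ] at h1
  have h2 := hP r (fun z => ψ (κ * z)) fun u v huv => hmono (mul_le_mul_of_nonneg_left huv hκ)
  have h3 : r m * (ψ w' - ψ w) ≤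
      ∑ m, r m * (ψ (κ * P.mulVec r m + d m * r m) - ψ (κ * P.mulVec r m)) :=
    Finset.single_le_sum
      (f := fun m => r m * (ψ (κ * P.mulVec r m + d m * r m) - ψ (κ * P.mulVec r m)))
      (fun m _ => mul_monotone_increment_nonneg hmono (hd m).le _ _) (Finset.mem_univ m)
  have h4 : ψ w = w := by
    simp [hψ]
  have h5 : ψ w' = w' := by
    simp [hψ]
  rw [h4, h5, hw', add_sub_cancel_left] at h3
  have h6 : d m * |r m| ^ 2 ≤ d m * |r m| := by
    rw [sq_abs]
    nlinarith
  have h7 := hd m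
  have h8 : |r m| ^ 2 ≤ |r m| := le_of_mul_le_mul_left h6 h7
  by_contra hlt
  nlinarith [abs_nonneg (r m)]

end Algebra

/-! ### Uniform asymptotic stability of the unforced filter -/

section Stability

variable {n : ℕ} {E : Set (Fin (n + 1) × Fin (n + 1))} {α : ℝ} {ε : Fin n → ℝ}
  {S : MeasurementSchedule n E} {P Pm : ℝ → Matrix (Fin n) (Fin n) ℝ}

/-- The Riccati equations of the filter. -/
abbrev IsCovarianceFlow (α : ℝ) (ε : Fin n → ℝ) (S : MeasurementSchedule n E)
    (P Pm : ℝ → Matrix (Fin n) (Fin n) ℝ) : Prop :=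
  IsImpulsiveSolution S.times (fun Q => -(2 * α) • Q + (Matrix.diagonal ε) ^ 2)
    (fun t Q => covarianceUpdate (S.link t) (S.variance t) Q) 0 0 P Pm

/-- The equations of the unforced filter. -/
abbrev IsUnforcedFlow (α : ℝ) (S : MeasurementSchedule n E)
    (Pm : ℝ → Matrix (Fin n) (Fin n) ℝ) (t₀ : ℝ) (x₀ : Fin n → ℝ) (x xm : ℝ → Fin n → ℝ) : Prop :=
  IsImpulsiveSolution S.times (fun x : Fin n → ℝ => -α • x)
    (fun t x => estimateUpdate (Pm t) (S.link t) (S.variance t) 0 x) t₀ x₀ x xm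

/-- The variance that an Ornstein-Uhlenbeck process gains within the time `h`. -/
noncomputable def gainedVariance (α : ℝ) (ε : Fin n → ℝ) (h : ℝ) (m : Fin n) : ℝ :=
  ε m ^ 2 * (1 - Real.exp (-(2 * α) * h)) / (2 * α)

theorem gainedVariance_pos (hα : 0 < α) (hε : ∀ m, 0 < ε m) {h : ℝ} (hh : 0 < h) (m : Fin n) :
    0 < gainedVariance α ε h m := by
  have h1 : Real.exp (-(2 * α) * h) < 1 := Real.exp_lt_one_iff.2 (by nlinarith)
  have h2 := hε m
  have h3 : 0 < 1 - Real.exp (-(2 * α) * h) := by linarith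
  unfold gainedVariance
  positivity

theorem IsCovarianceFlow.flow (hα : 0 < α) (hP : IsCovarianceFlow α ε S P Pm) {s t : ℝ}
    (hs : 0 ≤ s) (hst : s < t) (hT : ∀ u ∈ Set.Ioo s t, u ∉ S.times) (m l : Fin n) :
    Pm t m l = Real.exp (-(2 * α) * (t - s)) * P s m l
      + if m = l then gainedVariance α ε (t - s) m else 0 := by
  rw [hP.covariance_flow hα.ne' hs hst hT]
  congr 1
  split_ifs with h <;> simp [gainedVariance]

theorem psd_of_power_nonneg {P : Matrix (Fin n) (Fin n) ℝ}
    (h : ∀ (r : Fin n → ℝ) (ψ : ℝ → ℝ), Monotone ψ → 0 ≤ power P r ψ) (r : Fin n → ℝ) :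
    0 ≤ r ⬝ᵥ P.mulVec r := by
  rw [← power_id]
  exact h r id monotone_id

/-- Passivity of the network for every monotone `ψ`. The case `ψ = id` is positive semidefiniteness,
which makes the innovation variance positive and so lets the induction pass a jump. -/
theorem IsCovarianceFlow.symm_and_power_nonneg (hα : 0 < α) (hε : ∀ m, 0 < ε m)
    (hE : ∀ e ∈ E, e.1 ≠ e.2) (hP : IsCovarianceFlow α ε S P Pm) :
    ∀ t, 0 ≤ t →
      ((∀ m l, Pm t m l = Pm t l m) ∧
        ∀ (r : Fin n → ℝ) (ψ : ℝ → ℝ), Monotone ψ → 0 ≤ power (Pm t) r ψ) ∧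
      ((∀ m l, P t m l = P t l m) ∧
        ∀ (r : Fin n → ℝ) (ψ : ℝ → ℝ), Monotone ψ → 0 ≤ power (P t) r ψ) := by
  refine impulsive_induction S.locallyFinite ?_ ?_ ?_
  · rw [hP.init]
    exact ⟨fun m l => rfl, fun r ψ _ => by simp [power]⟩
  · rintro t ht ⟨hsym, hpow⟩
    by_cases htT : t ∈ S.times
    · have hne := hE _ (S.link_mem t htT)
      have hσ : (0 : ℝ) < S.variance t := S.variance_pos t htT
      rw [hP.jump t ht htT]
      refine ⟨fun m l => ?_, fun r ψ hψ => ?_⟩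
      · rw [covarianceUpdate_eq hne hsym, covarianceUpdate_eq hne hsym, hsym m l]
        ring
      · obtain ⟨r', -, h⟩ := exists_power_jump_le hne hsym (psd_of_power_nonneg hpow) hσ r
        exact (hpow r' ψ hψ).trans (h ψ hψ)
    · rw [hP.noJump t ht htT]
      exact ⟨hsym, hpow⟩
  · rintro s t hs hst hT ⟨hsym, hpow⟩
    refine ⟨fun m l => ?_, fun r ψ hψ => ?_⟩
    · rw [hP.flow hα hs hst hT, hP.flow hα hs hst hT, hsym]
      rcases eq_or_ne m l with rfl | hml
      · rfl
      · rw [if_neg hml, if_neg hml.symm]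
    · refine le_trans (hpow r (fun z => ψ (Real.exp (-(2 * α) * (t - s)) * z)) ?_)
        (power_flow_ge (fun m => (gainedVariance_pos hα hε (sub_pos.2 hst) m).le)
          (hP.flow hα hs hst hT) r hψ)
      exact fun u v huv => hψ (mul_le_mul_of_nonneg_left huv (Real.exp_pos _).le)

/-- Backward propagation of a covector through the unforced filter, which does not increase the
power. -/
theorem IsCovarianceFlow.exists_backward (hα : 0 < α) (hε : ∀ m, 0 < ε m)
    (hE : ∀ e ∈ E, e.1 ≠ e.2) (hP : IsCovarianceFlow α ε S P Pm) {t₀ : ℝ} (ht₀ : 0 ≤ t₀)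
    {x₀ : Fin n → ℝ} {x xm : ℝ → Fin n → ℝ} (hx : IsUnforcedFlow α S Pm t₀ x₀ x xm) :
    ∀ t, t₀ ≤ t →
      (∀ r : Fin n → ℝ, ∃ r₀ : Fin n → ℝ, r ⬝ᵥ xm t = Real.exp (-α * (t - t₀)) * (r₀ ⬝ᵥ x₀) ∧
        ∀ ψ : ℝ → ℝ, Monotone ψ → power (Pm t₀) r₀ ψ
          ≤ power (Pm t) r (fun z => ψ (Real.exp (2 * α * (t - t₀)) * z))) ∧
      (∀ r : Fin n → ℝ, ∃ r₀ : Fin n → ℝ, r ⬝ᵥ x t = Real.exp (-α * (t - t₀)) * (r₀ ⬝ᵥ x₀) ∧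
        ∀ ψ : ℝ → ℝ, Monotone ψ → power (Pm t₀) r₀ ψ
          ≤ power (P t) r (fun z => ψ (Real.exp (2 * α * (t - t₀)) * z))) := by
  have hmono : ∀ {ψ : ℝ → ℝ} (c : ℝ), Monotone ψ → Monotone fun z => ψ (Real.exp c * z) :=
    fun c hψ u v huv => hψ (mul_le_mul_of_nonneg_left huv (Real.exp_pos _).le)
  refine impulsive_induction S.locallyFinite (fun r => ⟨r, ?_, fun ψ _ => ?_⟩) ?_ ?_
  · simp [hx.init]
  · simp
  · intro t ht ih r
    have ht0 := ht₀.trans ht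
    by_cases htT : t ∈ S.times
    · have hne := hE _ (S.link_mem t htT)
      have hσ : (0 : ℝ) < S.variance t := S.variance_pos t htT
      obtain ⟨hsym, hpow⟩ := (hP.symm_and_power_nonneg hα hε hE t ht0).1
      obtain ⟨r', h1, h2⟩ := exists_power_jump_le hne hsym (psd_of_power_nonneg hpow) hσ r
      obtain ⟨r₀, h3, h4⟩ := ih r'
      refine ⟨r₀, ?_, fun ψ hψ => ?_⟩
      · rw [hx.jump t ht htT, h1, h3]
      · rw [hP.jump t ht0 htT]
        exact (h4 ψ hψ).trans (h2 _ (hmono _ hψ))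
    · rw [hx.noJump t ht htT, hP.noJump t ht0 htT]
      exact ih r
  · intro s t hs hst hT ih r
    obtain ⟨r₀, h3, h4⟩ := ih r
    refine ⟨r₀, ?_, fun ψ hψ => (h4 ψ hψ).trans ?_⟩
    · have h1 : xm t = Real.exp (-α * (t - s)) • x s :=
        funext fun m => hx.decay_flow hα.ne' hs hst hT m
      rw [h1, dotProduct_smul, h3, smul_eq_mul, ← mul_assoc, ← Real.exp_add]
      ring_nf
    -- The factor `exp (-2α (t - s))` of the covariance flow is absorbed into the rescaled argument
    -- of `ψ`, which stays monotone.
    · refine le_trans (le_of_eq ?_)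
        (power_flow_ge (fun m => (gainedVariance_pos hα hε (sub_pos.2 hst) m).le)
          (hP.flow hα (ht₀.trans hs) hst hT) r (hmono _ hψ))
      congr 1
      funext z
      rw [← mul_assoc, ← Real.exp_add]
      ring_nf

/-- Since `t₀ > 0`, some event-free time precedes it, and the variance gained there is the positive
series resistor at each terminal that the current bound needs. Its size does not enter the estimate.
-/
theorem IsUnforcedFlow.abs_le_of_pos (hα : 0 < α) (hε : ∀ m, 0 < ε m)
    (hE : ∀ e ∈ E, e.1 ≠ e.2) (hP : IsCovarianceFlow α ε S P Pm) {t₀ : ℝ} (ht₀ : 0 < t₀)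
    {x₀ : Fin n → ℝ} {x xm : ℝ → Fin n → ℝ} (hx : IsUnforcedFlow α S Pm t₀ x₀ x xm) {t : ℝ}
    (ht : t₀ ≤ t) (m : Fin n) : |x t m| ≤ Real.exp (-α * (t - t₀)) * ∑ i, |x₀ i| := by
  obtain ⟨r₀, h1, h2⟩ := (hP.exists_backward hα hε hE ht₀.le hx t ht).2 (Pi.single m 1)
  obtain ⟨s, hs0, hst, hT⟩ := exists_last_before S.locallyFinite ht₀
  have hr : ∀ i, |r₀ i| ≤ 1 := by
    refine abs_le_one_of_power_le (gainedVariance_pos hα hε (sub_pos.2 hst))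
      (hP.flow hα hs0 hst hT) (hP.symm_and_power_nonneg hα hε hE s hs0).2.2
      (Real.exp_pos _).le r₀ fun ψ h hψ hwin => (h2 ψ hψ).trans ?_
    -- The unit current at `m` has power equal to one increment of `ψ`, at most the window height.
    simp only [power, Pi.single_apply, ite_mul, one_mul, zero_mul, Finset.sum_ite_eq',
      Finset.mem_univ, if_true]
    exact hwin _ _
  rw [single_one_dotProduct] at h1
  rw [h1, abs_mul, abs_of_pos (Real.exp_pos _)]
  refine mul_le_mul_of_nonneg_left ?_ (Real.exp_pos _).le
  refine (Finset.abs_sum_le_sum_abs _ _).trans (Finset.sum_le_sum fun i _ => ?_)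
  rw [abs_mul]
  exact mul_le_of_le_one_left (abs_nonneg _) (hr i)

/-- At `t₀ = 0` the covariance vanishes and no series resistor is available. But then the gain is
zero too, so a measurement at `0` leaves the state unchanged, and the bound can be started at a
slightly later `t₁`. -/
theorem IsUnforcedFlow.abs_le (hα : 0 < α) (hε : ∀ m, 0 < ε m)
    (hE : ∀ e ∈ E, e.1 ≠ e.2) (hP : IsCovarianceFlow α ε S P Pm) {t₀ : ℝ} (ht₀ : 0 ≤ t₀)
    {x₀ : Fin n → ℝ} {x xm : ℝ → Fin n → ℝ} (hx : IsUnforcedFlow α S Pm t₀ x₀ x xm) {t : ℝ}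
    (ht : t₀ ≤ t) (m : Fin n) : |x t m| ≤ Real.exp (-α * (t - t₀)) * ∑ i, |x₀ i| := by
  rcases ht₀.eq_or_lt with rfl | hpos
  swap
  · exact hx.abs_le_of_pos hα hε hE hP hpos ht m
  have hx0 : x 0 = x₀ := by
    by_cases h0 : (0 : ℝ) ∈ S.times
    · rw [hx.jump 0 le_rfl h0, hP.init, hx.init]
      funext i
      rw [estimateUpdate_eq (hE _ (S.link_mem 0 h0))]
      simp [linkCov, dotProduct]
    · rw [hx.noJump 0 le_rfl h0, hx.init]
  rcases ht.eq_or_lt with rfl | htpos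
  · rw [hx0]
    simpa using Finset.single_le_sum (f := fun i => |x₀ i|) (fun i _ => abs_nonneg _)
      (Finset.mem_univ m)
  obtain ⟨δ, hδ, hT⟩ := exists_isolating_radius S.locallyFinite 0
  -- Halving `δ` keeps the interval `(0, t₁)` free of events.
  set t₁ := min (δ / 2) t with ht₁
  have h1 : 0 < t₁ := lt_min (by positivity) htpos
  have h1t : t₁ ≤ t := min_le_right _ _
  have hflow : xm t₁ = Real.exp (-α * (t₁ - 0)) • x 0 :=
    funext fun i => hx.decay_flow hα.ne' le_rfl h1 (fun u hu => hT u (by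
      have : t₁ ≤ δ / 2 := min_le_left _ _
      rw [sub_zero, abs_of_pos hu.1]
      linarith [hu.2]) hu.1.ne') i
  refine (IsUnforcedFlow.abs_le_of_pos hα hε hE hP h1 (hx.restrict h1.le) h1t m).trans
    (le_of_eq ?_)
  have h2 : ∀ i, |xm t₁ i| = Real.exp (-α * (t₁ - 0)) * |x₀ i| := fun i => by
    rw [hflow, hx0, Pi.smul_apply, smul_eq_mul, abs_mul, abs_of_pos (Real.exp_pos _)]
  simp only [h2, ← Finset.mul_sum]
  rw [← mul_assoc, ← Real.exp_add]
  ring_nf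

theorem isUniformlyAsymptoticallyStable_unforced (hα : 0 < α) (hε : ∀ m, 0 < ε m)
    (hE : ∀ e ∈ E, e.1 ≠ e.2) (hP : IsCovarianceFlow α ε S P Pm) :
    IsUniformlyAsymptoticallyStable S.times (fun x : Fin n → ℝ => -α • x)
      (fun t x => estimateUpdate (Pm t) (S.link t) (S.variance t) 0 x) := by
  -- The constant is `n + 1` rather than `n` so that it can be divided by when there are no clocks.
  have hbound : ∀ t₀ ≥ (0 : ℝ), ∀ (x₀ : Fin n → ℝ) (x xm : ℝ → Fin n → ℝ),
      IsUnforcedFlow α S Pm t₀ x₀ x xm → ∀ t ≥ t₀,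
      ‖x t‖ ≤ Real.exp (-α * (t - t₀)) * ((n + 1) * ‖x₀‖) := by
    intro t₀ ht₀ x₀ x xm hx t ht
    refine (pi_norm_le_iff_of_nonneg (by positivity)).2 fun m => ?_
    rw [Real.norm_eq_abs]
    refine (hx.abs_le hα hε hE hP ht₀ ht m).trans
      (mul_le_mul_of_nonneg_left ?_ (Real.exp_pos _).le)
    calc ∑ i, |x₀ i| ≤ ∑ _i : Fin n, ‖x₀‖ := Finset.sum_le_sum fun i _ => norm_le_pi_norm x₀ i
      _ = n * ‖x₀‖ := by simp
      _ ≤ (n + 1) * ‖x₀‖ := by nlinarith [norm_nonneg x₀]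
  refine ⟨fun η hη => ⟨η / (n + 1), by positivity, ?_⟩, fun r hr η hη => ?_⟩
  · intro t₀ ht₀ x₀ x xm hx hx₀ t ht
    refine (hbound t₀ ht₀ x₀ x xm hx t ht).trans_lt ?_
    have h1 : Real.exp (-α * (t - t₀)) ≤ 1 := Real.exp_le_one_iff.2 (by nlinarith)
    rw [lt_div_iff₀ (by positivity)] at hx₀
    have h2 : 0 ≤ ((n : ℝ) + 1) * ‖x₀‖ := by positivity
    nlinarith
  · have hlim : Tendsto (fun τ : ℝ => Real.exp (-α * τ) * ((n + 1) * r)) atTop (𝓝 0) := by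
      have h1 : Tendsto (fun τ : ℝ => Real.exp (-α * τ)) atTop (𝓝 0) :=
        Real.tendsto_exp_atBot.comp (tendsto_id.const_mul_atTop_of_neg (by linarith))
      simpa using h1.mul_const (((n : ℝ) + 1) * r)
    obtain ⟨τ, hτ, hτ0⟩ := ((hlim.eventually (gt_mem_nhds hη)).and (eventually_gt_atTop 0)).exists
    refine ⟨τ, hτ0, fun t₀ ht₀ x₀ x xm hx hx₀ t ht => ?_⟩
    refine (hbound t₀ ht₀ x₀ x xm hx t (by linarith)).trans_lt (lt_of_le_of_lt ?_ hτ)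
    refine mul_le_mul (Real.exp_le_exp.2 (by nlinarith)) ?_ (by positivity) (Real.exp_pos _).le
    exact mul_le_mul_of_nonneg_left hx₀.le (by positivity)

end Stability

/-! ### Spaces of centred Gaussian variables and their almost sure limits -/

section GaussianLimit

variable {Ω : Type*} [MeasurableSpace Ω] {μ : Measure Ω}

theorem memLp_two_of_hasLaw {Y : Ω → ℝ} {V : ℝ≥0} (h : HasLaw Y (gaussianReal 0 V) μ) :
    MemLp Y 2 μ := h.hasGaussianLaw.memLp_two

theorem integral_of_hasLaw {Y : Ω → ℝ} {V : ℝ≥0} (h : HasLaw Y (gaussianReal 0 V) μ) :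
    ∫ ω, Y ω ∂μ = 0 := by
  rw [h.integral_eq, integral_id_gaussianReal]

theorem integral_mul_self_of_hasLaw [IsProbabilityMeasure μ] {Y : Ω → ℝ} {V : ℝ≥0}
    (h : HasLaw Y (gaussianReal 0 V) μ) : ∫ ω, Y ω * Y ω ∂μ = V := by
  have h1 := covariance_eq_sub (memLp_two_of_hasLaw h) (memLp_two_of_hasLaw h)
  rw [integral_of_hasLaw h, covariance_self h.aemeasurable, h.variance_eq,
    variance_id_gaussianReal] at h1
  simpa using h1.symm

/-- Dominated convergence gives convergence of the characteristic functions `exp (-V u² / 2)`. No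
bound on the variances is needed beforehand: their convergence is read off at one frequency. -/
theorem hasLaw_gaussianReal_of_tendsto [IsProbabilityMeasure μ] {Y : ℕ → Ω → ℝ} {Z : Ω → ℝ} {V : ℕ → ℝ≥0}
    (hY : ∀ k, HasLaw (Y k) (gaussianReal 0 (V k)) μ)
    (hlim : ∀ᵐ ω ∂μ, Tendsto (fun k => Y k ω) atTop (𝓝 (Z ω))) :
    ∃ v : ℝ≥0, Tendsto (fun k => (V k : ℝ)) atTop (𝓝 v) ∧ HasLaw Z (gaussianReal 0 v) μ := by
  have hZ : AEMeasurable Z μ :=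
    aemeasurable_of_tendsto_metrizable_ae' (fun k => (hY k).aemeasurable) hlim
  have hPZ : IsProbabilityMeasure (μ.map Z) := Measure.isProbabilityMeasure_map hZ
  have hch : ∀ u : ℝ, Tendsto (fun k => Complex.exp (-((V k : ℝ) * u ^ 2 / 2 : ℝ))) atTop
      (𝓝 (charFun (μ.map Z) u)) := by
    intro u
    have h1 : ∀ k, Complex.exp (-((V k : ℝ) * u ^ 2 / 2 : ℝ))
        = ∫ ω, Complex.exp (u * Y k ω * Complex.I) ∂μ := by
      intro k
      have h2 := charFun_gaussianReal (μ := 0) (v := V k) u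
      rw [← (hY k).map_eq, charFun_apply_real, integral_map (hY k).aemeasurable (by fun_prop)] at h2
      rw [h2]
      congr 1
      push_cast
      ring
    simp only [h1]
    rw [charFun_apply_real, integral_map hZ (by fun_prop)]
    refine tendsto_integral_of_dominated_convergence (fun _ => (1 : ℝ)) (fun k => ?_)
      (integrable_const _) (fun k => ?_) ?_
    · have := (hY k).aemeasurable
      exact AEMeasurable.aestronglyMeasurable (by fun_prop)
    · refine ae_of_all _ fun ω => le_of_eq ?_
      rw [← Complex.ofReal_mul, Complex.norm_exp_ofReal_mul_I]
    · filter_upwards [hlim] with ω hω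
      have hc : Continuous fun x : ℝ => Complex.exp (u * x * Complex.I) := by fun_prop
      exact (hc.tendsto _).comp hω
  -- The limit is a characteristic function, hence nonzero near `0`; at such a frequency the
  -- logarithm recovers the variances.
  obtain ⟨u₀, hu₀, hne⟩ : ∃ u₀ : ℝ, u₀ ≠ 0 ∧ charFun (μ.map Z) u₀ ≠ 0 := by
    have hc : ContinuousAt (charFun (μ.map Z)) 0 := continuous_charFun.continuousAt
    have h0 : charFun (μ.map Z) 0 ≠ 0 := by simp
    have h1 : ∀ᶠ u in 𝓝[≠] (0 : ℝ), charFun (μ.map Z) u ≠ 0 :=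
      (hc.eventually_ne h0).filter_mono nhdsWithin_le_nhds
    obtain ⟨u, hu, hu'⟩ := (h1.and self_mem_nhdsWithin).exists
    exact ⟨u, hu', hu⟩
  have hnorm : Tendsto (fun k => Real.exp (-((V k : ℝ) * u₀ ^ 2 / 2))) atTop
      (𝓝 ‖charFun (μ.map Z) u₀‖) := by
    refine (hch u₀).norm.congr fun k => ?_
    rw [← Complex.ofReal_neg, Complex.norm_exp_ofReal]
  have hlog := hnorm.log (norm_ne_zero_iff.2 hne)
  simp only [Real.log_exp] at hlog
  have hV : Tendsto (fun k => (V k : ℝ)) atTop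
      (𝓝 (Real.log ‖charFun (μ.map Z) u₀‖ * (-2 / u₀ ^ 2))) := by
    refine (hlog.mul_const (-2 / u₀ ^ 2)).congr fun k => ?_
    field_simp
  set w := Real.log ‖charFun (μ.map Z) u₀‖ * (-2 / u₀ ^ 2)
  have hw : 0 ≤ w := ge_of_tendsto' hV fun k => (V k).2
  clear_value w
  lift w to ℝ≥0 using hw
  refine ⟨w, hV, hZ, ?_⟩
  refine Measure.ext_of_charFun (funext fun u => ?_)
  have h2 : Tendsto (fun k => Complex.exp (-((V k : ℝ) * u ^ 2 / 2 : ℝ))) atTop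
      (𝓝 (Complex.exp (-(w * u ^ 2 / 2 : ℝ)))) := by
    have hc : Continuous fun x : ℝ => Complex.exp (-(x * u ^ 2 / 2 : ℝ)) := by fun_prop
    exact (hc.tendsto (w : ℝ)).comp hV
  rw [tendsto_nhds_unique (hch u) h2, charFun_gaussianReal]
  congr 1
  simp

/-- A space of centred Gaussian random variables. -/
def IsGaussianSpace (μ : Measure Ω) (H : Submodule ℝ (Ω → ℝ)) : Prop :=
  ∀ Y ∈ H, ∃ V : ℝ≥0, HasLaw Y (gaussianReal 0 V) μ

/-- The almost sure limits of sequences in a space of random variables. -/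
def aeClosure (μ : Measure Ω) (H : Submodule ℝ (Ω → ℝ)) : Submodule ℝ (Ω → ℝ) where
  carrier := {Z | ∃ Y : ℕ → Ω → ℝ, (∀ k, Y k ∈ H) ∧
    ∀ᵐ ω ∂μ, Tendsto (fun k => Y k ω) atTop (𝓝 (Z ω))}
  zero_mem' := ⟨fun _ => 0, fun _ => H.zero_mem, ae_of_all _ fun _ => tendsto_const_nhds⟩
  add_mem' := by
    rintro _ _ ⟨Y, hY, h⟩ ⟨Y', hY', h'⟩
    refine ⟨fun k => Y k + Y' k, fun k => H.add_mem (hY k) (hY' k), ?_⟩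
    filter_upwards [h, h'] with ω h1 h2 using h1.add h2
  smul_mem' := by
    rintro c _ ⟨Y, hY, h⟩
    refine ⟨fun k => c • Y k, fun k => H.smul_mem c (hY k), ?_⟩
    filter_upwards [h] with ω h1 using h1.const_smul c

theorem le_aeClosure (H : Submodule ℝ (Ω → ℝ)) : H ≤ aeClosure μ H :=
  fun Y hY => ⟨fun _ => Y, fun _ => hY, ae_of_all _ fun _ => tendsto_const_nhds⟩

variable {H : Submodule ℝ (Ω → ℝ)}

theorem IsGaussianSpace.aeClosure [IsProbabilityMeasure μ] (hH : IsGaussianSpace μ H) :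
    IsGaussianSpace μ (aeClosure μ H) := by
  rintro Z ⟨Y, hY, h⟩
  choose V hV using fun k => hH _ (hY k)
  obtain ⟨v, -, hv⟩ := hasLaw_gaussianReal_of_tendsto hV h
  exact ⟨v, hv⟩

theorem IsGaussianSpace.memLp (hH : IsGaussianSpace μ H) {Y : Ω → ℝ} (hY : Y ∈ H) :
    MemLp Y 2 μ := by
  obtain ⟨V, hV⟩ := hH Y hY
  exact memLp_two_of_hasLaw hV

theorem IsGaussianSpace.integral_eq_zero (hH : IsGaussianSpace μ H) {Y : Ω → ℝ} (hY : Y ∈ H) :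
    ∫ ω, Y ω ∂μ = 0 := by
  obtain ⟨V, hV⟩ := hH Y hY
  exact integral_of_hasLaw hV

theorem IsGaussianSpace.integrable_mul (hH : IsGaussianSpace μ H) {Y Z : Ω → ℝ} (hY : Y ∈ H)
    (hZ : Z ∈ H) : Integrable (fun ω => Y ω * Z ω) μ :=
  (hH.memLp hY).integrable_mul (hH.memLp hZ)

/-- The covariance form of a space of centred Gaussian random variables. -/
noncomputable def IsGaussianSpace.cov (hH : IsGaussianSpace μ H) : H →ₗ[ℝ] H →ₗ[ℝ] ℝ :=
  LinearMap.mk₂ ℝ (fun Y Z => ∫ ω, Y.1 ω * Z.1 ω ∂μ)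
    (fun Y Y' Z => by
      rw [← integral_add (hH.integrable_mul Y.2 Z.2) (hH.integrable_mul Y'.2 Z.2)]
      exact integral_congr_ae (ae_of_all _ fun ω => by simp [add_mul]))
    (fun c Y Z => by
      rw [smul_eq_mul, ← integral_const_mul]
      exact integral_congr_ae (ae_of_all _ fun _ => by simp [mul_assoc]))
    (fun Y Z Z' => by
      rw [← integral_add (hH.integrable_mul Y.2 Z.2) (hH.integrable_mul Y.2 Z'.2)]
      exact integral_congr_ae (ae_of_all _ fun ω => by simp [mul_add]))
    (fun c Y Z => by
      rw [smul_eq_mul, ← integral_const_mul]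
      exact integral_congr_ae (ae_of_all _ fun _ => by simp; ring))

theorem IsGaussianSpace.cov_apply (hH : IsGaussianSpace μ H) (Y Z : H) :
    hH.cov Y Z = ∫ ω, Y.1 ω * Z.1 ω ∂μ := rfl

theorem IsGaussianSpace.cov_comm (hH : IsGaussianSpace μ H) (Y Z : H) :
    hH.cov Y Z = hH.cov Z Y := by
  simp only [cov_apply, mul_comm]

theorem IsGaussianSpace.cov_self_nonneg (hH : IsGaussianSpace μ H) (Y : H) : 0 ≤ hH.cov Y Y :=
  integral_nonneg fun _ => mul_self_nonneg _

theorem IsGaussianSpace.cov_congr (hH : IsGaussianSpace μ H) {Y Y' : H} (Z : H)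
    (h : Y.1 =ᵐ[μ] Y'.1) : hH.cov Y Z = hH.cov Y' Z := by
  simp only [cov_apply]
  refine integral_congr_ae ?_
  filter_upwards [h] with ω hω
  rw [hω]

theorem IsGaussianSpace.tendsto_cov_self [IsProbabilityMeasure μ] (hH : IsGaussianSpace μ H) {Y : ℕ → H} {Z : H}
    (h : ∀ᵐ ω ∂μ, Tendsto (fun k => (Y k).1 ω) atTop (𝓝 (Z.1 ω))) :
    Tendsto (fun k => hH.cov (Y k) (Y k)) atTop (𝓝 (hH.cov Z Z)) := by
  choose V hV using fun k => hH _ (Y k).2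
  obtain ⟨v, h1, hv⟩ := hasLaw_gaussianReal_of_tendsto hV h
  simp only [cov_apply, integral_mul_self_of_hasLaw hv, integral_mul_self_of_hasLaw (hV _)]
  exact h1

theorem IsGaussianSpace.tendsto_cov [IsProbabilityMeasure μ] (hH : IsGaussianSpace μ H) {Y Y' : ℕ → H} {Z Z' : H}
    (h : ∀ᵐ ω ∂μ, Tendsto (fun k => (Y k).1 ω) atTop (𝓝 (Z.1 ω)))
    (h' : ∀ᵐ ω ∂μ, Tendsto (fun k => (Y' k).1 ω) atTop (𝓝 (Z'.1 ω))) :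
    Tendsto (fun k => hH.cov (Y k) (Y' k)) atTop (𝓝 (hH.cov Z Z')) := by
  -- Polarization reduces covariances to variances, which converge with the Gaussian laws.
  have hpol : ∀ A B : H, hH.cov A B
      = (hH.cov (A + B) (A + B) - hH.cov A A - hH.cov B B) / 2 := by
    intro A B
    simp only [map_add, LinearMap.add_apply, hH.cov_comm B A]
    ring
  have hsum : ∀ᵐ ω ∂μ, Tendsto (fun k => (Y k + Y' k).1 ω) atTop (𝓝 ((Z + Z').1 ω)) := by
    filter_upwards [h, h'] with ω h1 h2 using h1.add h2
  rw [hpol Z Z']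
  simp only [hpol (Y _) (Y' _)]
  exact (((hH.tendsto_cov_self hsum).sub (hH.tendsto_cov_self h)).sub
    (hH.tendsto_cov_self h')).div_const 2

/-- A linear functional of finitely many members is again a member, hence Gaussian; this gives joint
Gaussianity. -/
theorem IsGaussianSpace.isGaussianProcess (hH : IsGaussianSpace μ H) :
    IsGaussianProcess (fun (Y : H) ω => Y.1 ω) μ where
  hasGaussianLaw I := by
    classical
    constructor
    refine isGaussian_of_map_eq_gaussianReal fun L => ?_
    have hm : AEMeasurable (fun ω => I.restrict fun Y : H => Y.1 ω) μ :=
      aemeasurable_pi_lambda _ fun Y => (hH.memLp Y.1.2).aestronglyMeasurable.aemeasurable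
    have h1 : (L ∘ fun ω => I.restrict fun Y : H => Y.1 ω)
        = ∑ Y : I, L (Pi.single Y 1) • Y.1.1 := by
      funext ω
      have h2 : I.restrict (fun Y : H => Y.1 ω)
          = ∑ Y : I, (Y.1.1 ω) • (Pi.single Y 1 : I → ℝ) := by
        funext Z
        simp [Finset.sum_apply, Pi.single_apply]
      simp only [Function.comp_apply, h2, map_sum, map_smul, smul_eq_mul, Finset.sum_apply,
        Pi.smul_apply, mul_comm]
    obtain ⟨V, hV⟩ := hH (∑ Y : I, L (Pi.single Y 1) • Y.1.1)
      (H.sum_mem fun Y _ => H.smul_mem _ Y.1.2)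
    refine ⟨0, V, ?_⟩
    rw [AEMeasurable.map_map_of_aemeasurable (by fun_prop) hm, h1]
    exact hV.map_eq

theorem IsGaussianSpace.indepFun [IsProbabilityMeasure μ] (hH : IsGaussianSpace μ H) {ι κ : Type*} (Y : ι → H)
    (Z : κ → H) (h : ∀ i j, hH.cov (Y i) (Z j) = 0) :
    IndepFun (fun ω i => (Y i).1 ω) (fun ω j => (Z j).1 ω) μ := by
  refine IsGaussianProcess.indepFun_of_covariance_eq_zero ?_
    (fun i => (hH.memLp (Y i).2).aestronglyMeasurable.aemeasurable)
    (fun j => (hH.memLp (Z j).2).aestronglyMeasurable.aemeasurable) fun i j => ?_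
  · refine (hH.isGaussianProcess.comp_right (Sum.elim Y Z)).congr fun k => ?_
    rcases k with i | j <;> rfl
  · rw [covariance_eq_sub (hH.memLp (Y i).2) (hH.memLp (Z j).2), hH.integral_eq_zero (Y i).2]
    rw [zero_mul, sub_zero]
    exact h i j

theorem isGaussianSpace_span {T : Type*} {G : T → Ω → ℝ} (hG : IsGaussianProcess G μ)
    (hmean : ∀ t, ∫ ω, G t ω ∂μ = 0) : IsGaussianSpace μ (Submodule.span ℝ (Set.range G)) := by
  intro Y hY
  obtain ⟨c, rfl⟩ := (Finsupp.mem_span_range_iff_exists_finsupp).1 hY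
  have hsum : (c.sum fun t a => a • G t) = ∑ t ∈ c.support, c t • G t := rfl
  rw [hsum]
  have h1 : HasGaussianLaw (∑ t ∈ c.support, c t • G t) μ :=
    (hG.smul (fun t => c t)).hasGaussianLaw_sum (I := c.support)
  have h2 : ∫ ω, (∑ t ∈ c.support, c t • G t) ω ∂μ = 0 := by
    simp only [Finset.sum_apply, Pi.smul_apply, smul_eq_mul]
    rw [integral_finsetSum _ fun t _ => ((hG.hasGaussianLaw_eval t).integrable.const_mul _)]
    simp [integral_const_mul, hmean]
  refine ⟨(Var[id; μ.map (∑ t ∈ c.support, c t • G t)]).toNNReal, h1.aemeasurable, ?_⟩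
  have h3 := h1.isGaussian_map.eq_gaussianReal
  rw [integral_map h1.aemeasurable (by fun_prop)] at h3
  simp only [id] at h3
  rw [h2] at h3
  exact h3

end GaussianLimit

/-! ### Discretized variation of constants -/

section Partition

/-- The points of the uniform partition of `[s, t]` into `N + 1` intervals. -/
noncomputable def gridPoint (s t : ℝ) (N k : ℕ) : ℝ := s + k * ((t - s) / (N + 1))

theorem gridPoint_zero (s t : ℝ) (N : ℕ) : gridPoint s t N 0 = s := by simp [gridPoint]

theorem gridPoint_last (s t : ℝ) (N : ℕ) : gridPoint s t N (N + 1) = t := by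
  unfold gridPoint
  push_cast
  field_simp
  ring

theorem gridPoint_succ (s t : ℝ) (N k : ℕ) :
    gridPoint s t N (k + 1) - gridPoint s t N k = (t - s) / (N + 1) := by
  unfold gridPoint
  push_cast
  ring

theorem gridPoint_mono {s t : ℝ} (hst : s ≤ t) (N : ℕ) : Monotone (gridPoint s t N) := by
  refine monotone_nat_of_le_succ fun k => ?_
  have h1 := gridPoint_succ s t N k
  have h2 : 0 ≤ (t - s) / ((N : ℝ) + 1) := div_nonneg (sub_nonneg.2 hst) (by positivity)
  linarith

theorem gridPoint_mem {s t : ℝ} (hst : s ≤ t) {N k : ℕ} (hk : k ≤ N + 1) :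
    gridPoint s t N k ∈ Set.Icc s t := by
  constructor
  · simpa [gridPoint_zero] using gridPoint_mono hst N (Nat.zero_le k)
  · simpa [gridPoint_last] using gridPoint_mono hst N hk

/-- Within one cell both arguments move by at most the mesh, so uniform continuity makes the
integrand small, while the cells have total length `t - s`. -/
theorem tendsto_sum_integral_grid {s t : ℝ} (hst : s ≤ t) {p : ℝ → ℝ → ℝ}
    (hp : ContinuousOn (Function.uncurry p) (Set.Icc s t ×ˢ Set.Icc s t)) :
    Tendsto (fun N : ℕ => ∑ k ∈ Finset.range (N + 1),
      ∫ u in gridPoint s t N k..gridPoint s t N (k + 1),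
        (p u (gridPoint s t N (k + 1)) - p (gridPoint s t N k) u)) atTop (𝓝 0) := by
  have hunif := (isCompact_Icc.prod isCompact_Icc).uniformContinuousOn_of_continuous hp
  rw [Metric.uniformContinuousOn_iff] at hunif
  have hmesh : Tendsto (fun N : ℕ => (t - s) / ((N : ℝ) + 1)) atTop (𝓝 0) :=
    tendsto_const_nhds.div_atTop (tendsto_atTop_add_const_right _ _ tendsto_natCast_atTop_atTop)
  rw [Metric.tendsto_nhds]
  intro η hη
  have hη' : 0 < η / (t - s + 1) := div_pos hη (by linarith)
  obtain ⟨δ, hδ, hδp⟩ := hunif _ hη'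
  filter_upwards [hmesh.eventually (gt_mem_nhds hδ)] with N hN
  rw [dist_zero_right]
  have hterm : ∀ k ∈ Finset.range (N + 1),
      ‖∫ u in gridPoint s t N k..gridPoint s t N (k + 1),
        (p u (gridPoint s t N (k + 1)) - p (gridPoint s t N k) u)‖
        ≤ η / (t - s + 1) * ((t - s) / (N + 1)) := by
    intro k hk
    have hk1 : k < N + 1 := Finset.mem_range.1 hk
    have hle := gridPoint_mono hst N (Nat.le_succ k)
    have hm1 := gridPoint_mem hst hk1.le
    have hm2 := gridPoint_mem hst (Nat.succ_le_of_lt hk1)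
    have hsucc := gridPoint_succ s t N k
    have h2 : 0 ≤ (t - s) / ((N : ℝ) + 1) := by linarith [Nat.succ_eq_add_one k ▸ hle]
    refine (intervalIntegral.norm_integral_le_of_norm_le_const (C := η / (t - s + 1))
      fun u hu => ?_).trans (le_of_eq ?_)
    · rw [Set.uIoc_of_le hle] at hu
      have hum : u ∈ Set.Icc s t := ⟨hm1.1.trans hu.1.le, hu.2.trans hm2.2⟩
      have h3 := hδp (u, gridPoint s t N (k + 1)) ⟨hum, hm2⟩ (gridPoint s t N k, u) ⟨hm1, hum⟩ ?_
      · rw [Real.dist_eq] at h3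
        exact h3.le
      · rw [Prod.dist_eq, Real.dist_eq, Real.dist_eq]
        refine max_lt ?_ ?_
        · rw [abs_of_nonneg (by linarith [hu.1])]
          have := hu.2
          simp only [Nat.succ_eq_add_one] at this
          linarith
        · have := hu.2
          simp only [Nat.succ_eq_add_one] at this
          rw [abs_of_nonneg (by linarith)]
          linarith [hu.1]
    · rw [hsucc, abs_of_nonneg h2]
  refine (norm_sum_le_of_le _ hterm).trans_lt ?_
  rw [Finset.sum_const, Finset.card_range, nsmul_eq_mul]
  have h4 : ((N + 1 : ℕ) : ℝ) * (η / (t - s + 1) * ((t - s) / (N + 1)))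
      = η * ((t - s) / (t - s + 1)) := by
    have : (0 : ℝ) < t - s + 1 := by linarith
    push_cast
    field_simp
  rw [h4]
  have : (t - s) / (t - s + 1) < 1 := (div_lt_one (by linarith)).2 (by linarith)
  nlinarith

/-- Discretized variation of constants for `x(t) = -α ∫₀ᵗ x + c w(t)`. -/
theorem tendsto_grid_increments {α c : ℝ} {x w : ℝ → ℝ} (hx : ContinuousOn x (Set.Ici 0))
    (hxw : ∀ t, 0 ≤ t → x t = -α * (∫ s in (0 : ℝ)..t, x s) + c * w t) {s t : ℝ} (hs : 0 ≤ s)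
    (hst : s ≤ t) :
    Tendsto (fun N : ℕ => ∑ k ∈ Finset.range (N + 1), Real.exp (α * gridPoint s t N k)
        * (c * (w (gridPoint s t N (k + 1)) - w (gridPoint s t N k)))) atTop
      (𝓝 (Real.exp (α * t) * x t - Real.exp (α * s) * x s)) := by
  have hxi : ∀ a b, 0 ≤ a → 0 ≤ b → IntervalIntegrable x volume a b := fun a b ha hb =>
    (hx.mono fun u hu => (le_min ha hb).trans hu.1).intervalIntegrable
  -- Summation by parts on one cell, exact by the integral equation. The integral is the error term
  -- that vanishes with the mesh.
  have hterm : ∀ a b, 0 ≤ a → 0 ≤ b →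
      Real.exp (α * b) * x b - Real.exp (α * a) * x a
        - ∫ u in a..b, (α * Real.exp (α * u) * x b - α * Real.exp (α * a) * x u)
      = Real.exp (α * a) * (c * (w b - w a)) := by
    intro a b ha hb
    have h1 : ∫ u in a..b, α * Real.exp (α * u) = Real.exp (α * b) - Real.exp (α * a) := by
      refine intervalIntegral.integral_eq_sub_of_hasDerivAt (f := fun u => Real.exp (α * u))
        (fun u _ => ?_) (Continuous.intervalIntegrable (by fun_prop) _ _)
      have := ((hasDerivAt_id u).const_mul α).exp
      refine this.congr_deriv ?_
      simp
      ring
    rw [intervalIntegral.integral_sub (Continuous.intervalIntegrable (by fun_prop) _ _)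
      ((hxi a b ha hb).const_mul _), intervalIntegral.integral_mul_const,
      h1, intervalIntegral.integral_const_mul]
    have h2 : (∫ u in (0 : ℝ)..b, x u) - ∫ u in (0 : ℝ)..a, x u = ∫ u in a..b, x u :=
      intervalIntegral.integral_interval_sub_left (hxi 0 b le_rfl hb) (hxi 0 a le_rfl ha)
    have h3 := hxw a ha
    have h4 := hxw b hb
    rw [← h2]
    linear_combination (-Real.exp (α * a)) * h3 + Real.exp (α * a) * h4
  have hp : ContinuousOn (Function.uncurry fun u v => α * Real.exp (α * u) * x v)
      (Set.Icc s t ×ˢ Set.Icc s t) := by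
    have h1 : ContinuousOn (fun q : ℝ × ℝ => x q.2) (Set.Icc s t ×ˢ Set.Icc s t) :=
      hx.comp continuousOn_snd fun q hq => hs.trans hq.2.1
    exact ((by fun_prop : Continuous fun q : ℝ × ℝ => α * Real.exp (α * q.1)).continuousOn).mul h1
  have hlim := (tendsto_sum_integral_grid hst hp).const_sub
    (Real.exp (α * t) * x t - Real.exp (α * s) * x s)
  rw [sub_zero] at hlim
  refine hlim.congr fun N => ?_
  have htel := Finset.sum_range_sub
    (fun k => Real.exp (α * gridPoint s t N k) * x (gridPoint s t N k)) (N + 1)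
  simp only [gridPoint_zero, gridPoint_last] at htel
  rw [← htel, ← Finset.sum_sub_distrib]
  refine Finset.sum_congr rfl fun k hk => ?_
  have hk1 : k < N + 1 := Finset.mem_range.1 hk
  exact hterm _ _ (hs.trans (gridPoint_mem hst hk1.le).1)
    (hs.trans (gridPoint_mem hst (Nat.succ_le_of_lt hk1)).1)

/-- Riemann sums of `exp (α u)`, obtained as the noise-free case `w = id` of the same formula; they
yield the variance of the increments. -/
theorem tendsto_grid_exp {α : ℝ} (hα : α ≠ 0) {s t : ℝ} (hs : 0 ≤ s) (hst : s ≤ t) :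
    Tendsto (fun N : ℕ => ∑ k ∈ Finset.range (N + 1), Real.exp (α * gridPoint s t N k)
        * (gridPoint s t N (k + 1) - gridPoint s t N k)) atTop
      (𝓝 ((Real.exp (α * t) - Real.exp (α * s)) / α)) := by
  have h := tendsto_grid_increments (α := α) (c := 1) (w := id)
    (x := fun u => (1 - Real.exp (-α * u)) / α)
    (by fun_prop) (fun u hu => ?_) hs hst
  · have h1 : ∀ u, Real.exp (α * u) * ((1 - Real.exp (-α * u)) / α)
        = (Real.exp (α * u) - 1) / α := by
      intro u
      rw [mul_div_assoc', mul_sub, ← Real.exp_add]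
      simp
    rw [h1, h1] at h
    simp only [one_mul, id] at h
    convert h using 2
    ring
  · have hd : ∀ z, HasDerivAt (fun u => (1 - Real.exp (-α * u)) / α) (Real.exp (-α * z)) z := by
      intro z
      have h1 := ((((hasDerivAt_id z).const_mul (-α)).exp).const_sub 1).div_const α
      refine h1.congr_deriv ?_
      simp
      field_simp
    have h2 := intervalIntegral.integral_eq_sub_of_hasDerivAt (a := 0) (b := u)
      (fun z _ => hd z) (Continuous.intervalIntegrable (by fun_prop) _ _)
    have h3 : ∫ z in (0 : ℝ)..u, (1 - Real.exp (-α * z)) / α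
        = (u - ∫ z in (0 : ℝ)..u, Real.exp (-α * z)) / α := by
      rw [intervalIntegral.integral_div, intervalIntegral.integral_sub
        (Continuous.intervalIntegrable (by fun_prop) _ _)
        (Continuous.intervalIntegrable (by fun_prop) _ _)]
      simp
    rw [h3, h2]
    simp
    field_simp
    ring

end Partition

/-! ### Covariances of states and noises in the clock model -/

section Model

variable {n : ℕ} {E : Set (Fin (n + 1) × Fin (n + 1))} {Ω : Type*} [MeasurableSpace Ω]
  {μ : Measure Ω} {α : ℝ} {ε : Fin n → ℝ} {S : MeasurementSchedule n E}
  {W X : Fin n → ℝ → Ω → ℝ} {v : ℝ → Ω → ℝ}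

/-- The Brownian motions and the measurement noises as one family. -/
def sources (S : MeasurementSchedule n E) (W : Fin n → ℝ → Ω → ℝ) (v : ℝ → Ω → ℝ) :
    (Fin n × ℝ≥0) ⊕ S.times → Ω → ℝ :=
  Sum.elim (fun p => W p.1 p.2) (fun t => v t)

/-- The space of Gaussian random variables generated by the sources. -/
def gaussianHull (μ : Measure Ω) (S : MeasurementSchedule n E) (W : Fin n → ℝ → Ω → ℝ)
    (v : ℝ → Ω → ℝ) : Submodule ℝ (Ω → ℝ) :=
  aeClosure μ (Submodule.span ℝ (Set.range (sources S W v)))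

theorem sources_mem_gaussianHull (k : (Fin n × ℝ≥0) ⊕ S.times) :
    sources S W v k ∈ gaussianHull μ S W v :=
  le_aeClosure _ (Submodule.subset_span ⟨k, rfl⟩)

namespace IsClockModel

/-- Each Brownian motion is a Gaussian process, and independence makes the finite families of all
motions and noises jointly Gaussian. Finitely many sources are continuous linear images of such a
family. -/
theorem isGaussianProcess_sources [IsProbabilityMeasure μ]
    (hM : IsClockModel μ α ε S W X v) : IsGaussianProcess (sources S W v) μ where
  hasGaussianLaw K := by
    classical
    set I : Finset ℝ≥0 := K.biUnion fun k => Sum.elim (fun p => {p.2}) (fun _ => ∅) k with hI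
    set J : Finset S.times := K.biUnion fun k => Sum.elim (fun _ => ∅) (fun t => {t}) k with hJ
    have hA : HasGaussianLaw (fun ω m => I.restrict fun t : ℝ≥0 => W m t ω) μ := by
      refine iIndepFun.hasGaussianLaw
        (fun m => (IsPreBrownianReal.isGaussianProcess
          (hM.brownian m).toIsPreBrownianReal).hasGaussianLaw I) ?_
      exact hM.indep_W.comp (fun _ => I.restrict) fun _ => by fun_prop
    have hB : HasGaussianLaw (fun ω (t : J) => v (t : S.times) ω) μ := by
      refine iIndepFun.hasGaussianLaw
        (fun t => (hM.noise_law _ t.1.2).hasGaussianLaw) ?_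
      exact hM.indep_v.precomp (g := fun t : J => t.1) Subtype.val_injective
    have hind := hM.indep_W_v.comp
      (φ := fun (w : Fin n → ℝ≥0 → ℝ) (m : Fin n) => I.restrict (w m))
      (ψ := fun (z : S.times → ℝ) (t : J) => z t) (by fun_prop) (by fun_prop)
    have hpair := IndepFun.hasGaussianLaw hA hB hind
    have hL : ∀ k : K, ∃ L : ((Fin n → I → ℝ) × (J → ℝ)) →L[ℝ] ℝ, ∀ ω,
        sources S W v k ω = L (fun m => I.restrict fun t : ℝ≥0 => W m t ω, fun t => v t ω) := by
      rintro ⟨⟨m, t⟩ | t, hk⟩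
      · have ht : t ∈ I := Finset.mem_biUnion.2 ⟨_, hk, by simp⟩
        exact ⟨(ContinuousLinearMap.proj (R := ℝ) (⟨t, ht⟩ : I)).comp
          ((ContinuousLinearMap.proj (R := ℝ) (φ := fun _ : Fin n => I → ℝ) m).comp
            (ContinuousLinearMap.fst ℝ _ _)), fun ω => rfl⟩
      · have ht : t ∈ J := Finset.mem_biUnion.2 ⟨_, hk, by simp⟩
        exact ⟨(ContinuousLinearMap.proj (R := ℝ) (⟨t, ht⟩ : J)).comp
          (ContinuousLinearMap.snd ℝ _ _), fun ω => rfl⟩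
    choose L hL using hL
    have := hpair.map (ContinuousLinearMap.pi L)
    refine (congrArg (HasGaussianLaw · μ) (funext fun ω => funext fun k => ?_)).mpr this
    exact hL k ω

theorem integral_W (hM : IsClockModel μ α ε S W X v) (m : Fin n) (t : ℝ≥0) : ∫ ω, W m t ω ∂μ = 0 :=
  (hM.brownian m).integral_eval t

theorem integral_v (hM : IsClockModel μ α ε S W X v) (t : S.times) : ∫ ω, v t ω ∂μ = 0 :=
  integral_of_hasLaw (hM.noise_law t t.2)

theorem isGaussianSpace [IsProbabilityMeasure μ]
    (hM : IsClockModel μ α ε S W X v) : IsGaussianSpace μ (gaussianHull μ S W v) := by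
  refine (isGaussianSpace_span hM.isGaussianProcess_sources ?_).aeClosure
  rintro (⟨m, t⟩ | t)
  · exact hM.integral_W m t
  · exact hM.integral_v t
/-- The Brownian motion of clock `m` at time `max t 0`. -/
def brownianElem (_hM : IsClockModel μ α ε S W X v) (m : Fin n) (t : ℝ) : gaussianHull μ S W v :=
  ⟨W m t.toNNReal, sources_mem_gaussianHull (Sum.inl (m, t.toNNReal))⟩

/-- The noise of a measurement. -/
def noiseElem (_hM : IsClockModel μ α ε S W X v) (t : S.times) : gaussianHull μ S W v :=
  ⟨v t, sources_mem_gaussianHull (Sum.inr t)⟩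

/-- A discretization of the increment of `e^{α t} X_m(t)`. -/
noncomputable def gridIncrement (hM : IsClockModel μ α ε S W X v) (m : Fin n) (s t : ℝ) (N : ℕ) :
    gaussianHull μ S W v :=
  ∑ k ∈ Finset.range (N + 1), (Real.exp (α * gridPoint s t N k) * ε m) •
    (hM.brownianElem m (gridPoint s t N (k + 1)) - hM.brownianElem m (gridPoint s t N k))

theorem tendsto_gridIncrement (hM : IsClockModel μ α ε S W X v) (m : Fin n) {s t : ℝ}
    (hs : 0 ≤ s) (hst : s ≤ t) :
    ∀ᵐ ω ∂μ, Tendsto (fun N => (hM.gridIncrement m s t N).1 ω) atTop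
      (𝓝 (Real.exp (α * t) * X m t ω - Real.exp (α * s) * X m s ω)) := by
  filter_upwards [hM.continuous_X m, hM.sde m] with ω h1 h2
  refine (tendsto_grid_increments h1 h2 hs hst).congr fun N => ?_
  simp only [gridIncrement, AddSubmonoidClass.coe_finsetSum, Finset.sum_apply]
  refine Finset.sum_congr rfl fun k hk => ?_
  have hk1 : k < N + 1 := Finset.mem_range.1 hk
  have h3 := Real.coe_toNNReal _ (hs.trans (gridPoint_mem hst hk1.le).1)
  have h4 := Real.coe_toNNReal _ (hs.trans (gridPoint_mem hst (Nat.succ_le_of_lt hk1)).1)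
  simp only [Nat.succ_eq_add_one] at h4
  simp only [Submodule.coe_smul, Submodule.coe_sub, Pi.smul_apply, Pi.sub_apply, smul_eq_mul,
    brownianElem, h3, h4]
  ring

theorem ae_X_zero (hM : IsClockModel μ α ε S W X v) (m : Fin n) : X m 0 =ᵐ[μ] 0 := by
  filter_upwards [hM.sde m, (hM.brownian m).eval_zero_ae_eq_zero] with ω h1 h2
  have h2' : W m 0 ω = 0 := by simpa using h2
  simpa [h2'] using h1 0 le_rfl

theorem X_mem_gaussianHull (hM : IsClockModel μ α ε S W X v) (m : Fin n) {t : ℝ} (ht : 0 ≤ t) :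
    X m t ∈ gaussianHull μ S W v := by
  refine ⟨fun N => Real.exp (-(α * t)) • (hM.gridIncrement m 0 t N).1, fun N => ?_, ?_⟩
  · refine Submodule.smul_mem _ _ ?_
    simp only [gridIncrement, AddSubmonoidClass.coe_finsetSum]
    refine Submodule.sum_mem _ fun k _ => Submodule.smul_mem _ _ (Submodule.sub_mem _ ?_ ?_)
    · exact Submodule.subset_span ⟨Sum.inl (m, (gridPoint 0 t N (k + 1)).toNNReal), rfl⟩
    · exact Submodule.subset_span ⟨Sum.inl (m, (gridPoint 0 t N k).toNNReal), rfl⟩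
  · filter_upwards [hM.tendsto_gridIncrement m le_rfl ht, hM.ae_X_zero m] with ω h1 h2
    have h3 := h1.const_mul (Real.exp (-(α * t)))
    rw [h2, Pi.zero_apply, mul_zero, sub_zero, ← mul_assoc, ← Real.exp_add, neg_add_cancel,
      Real.exp_zero, one_mul] at h3
    exact h3

/-- The clock `m` at time `max t 0`. -/
def stateElem (hM : IsClockModel μ α ε S W X v) (m : Fin n) (t : ℝ) : gaussianHull μ S W v :=
  ⟨X m t.toNNReal, hM.X_mem_gaussianHull m t.toNNReal.2⟩

theorem coe_stateElem (hM : IsClockModel μ α ε S W X v) (m : Fin n) {t : ℝ} (ht : 0 ≤ t) :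
    (hM.stateElem m t).1 = X m t := by
  simp only [stateElem, Real.coe_toNNReal t ht]

theorem tendsto_gridIncrement_stateElem (hM : IsClockModel μ α ε S W X v) (m : Fin n) {s t : ℝ}
    (hs : 0 ≤ s) (hst : s ≤ t) :
    ∀ᵐ ω ∂μ, Tendsto (fun N => (hM.gridIncrement m s t N).1 ω) atTop
      (𝓝 ((Real.exp (α * t) • hM.stateElem m t - Real.exp (α * s) • hM.stateElem m s :
        gaussianHull μ S W v).1 ω)) := by
  simpa [hM.coe_stateElem m hs, hM.coe_stateElem m (hs.trans hst)] using
    hM.tendsto_gridIncrement m hs hst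

theorem tendsto_gridIncrement_zero (hM : IsClockModel μ α ε S W X v) (m : Fin n) {t : ℝ}
    (ht : 0 ≤ t) :
    ∀ᵐ ω ∂μ, Tendsto (fun N => (hM.gridIncrement m 0 t N).1 ω) atTop
      (𝓝 ((Real.exp (α * t) • hM.stateElem m t : gaussianHull μ S W v).1 ω)) := by
  filter_upwards [hM.tendsto_gridIncrement m le_rfl ht, hM.ae_X_zero m] with ω h1 h2
  simpa [h2, hM.coe_stateElem m ht] using h1

/-- The part of `X_m(t)` that the past up to time `s` does not determine. -/
noncomputable def freshElem (hM : IsClockModel μ α ε S W X v) (m : Fin n) (s t : ℝ) :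
    gaussianHull μ S W v :=
  hM.stateElem m t - Real.exp (-α * (t - s)) • hM.stateElem m s

theorem freshElem_eq (hM : IsClockModel μ α ε S W X v) (m : Fin n) (s t : ℝ) :
    hM.freshElem m s t = Real.exp (-(α * t)) •
      (Real.exp (α * t) • hM.stateElem m t - Real.exp (α * s) • hM.stateElem m s) := by
  rw [smul_sub, smul_smul, smul_smul, ← Real.exp_add, ← Real.exp_add, neg_add_cancel,
    Real.exp_zero, one_smul, freshElem]
  congr 3
  ring

variable [IsProbabilityMeasure μ]

theorem cov_brownian (hM : IsClockModel μ α ε S W X v) (m l : Fin n) (s t : ℝ) :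
    hM.isGaussianSpace.cov (hM.brownianElem m s) (hM.brownianElem l t)
      = if m = l then ((min s.toNNReal t.toNNReal : ℝ≥0) : ℝ) else 0 := by
  have hcov : hM.isGaussianSpace.cov (hM.brownianElem m s) (hM.brownianElem l t)
      = ∫ ω, W m s.toNNReal ω * W l t.toNNReal ω ∂μ := rfl
  rw [hcov]
  split_ifs with h
  · subst h
    have h1 := (hM.brownian m).covariance_eval s.toNNReal t.toNNReal
    rw [covariance_eq_sub
      (memLp_two_of_hasLaw ((hM.brownian m).hasLaw_eval _))
      (memLp_two_of_hasLaw ((hM.brownian m).hasLaw_eval _)), hM.integral_W] at h1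
    simpa using h1
  · have h1 : IndepFun (W m s.toNNReal) (W l t.toNNReal) μ :=
      (hM.indep_W.indepFun h).comp (φ := fun w : ℝ≥0 → ℝ => w s.toNNReal)
        (ψ := fun w : ℝ≥0 → ℝ => w t.toNNReal) (by fun_prop) (by fun_prop)
    have h2 := h1.integral_mul_eq_mul_integral
      (hM.measurable_W m _ s.toNNReal.2).aestronglyMeasurable
      (hM.measurable_W l _ t.toNNReal.2).aestronglyMeasurable
    rw [hM.integral_W, zero_mul] at h2
    exact h2

theorem cov_brownian_noise (hM : IsClockModel μ α ε S W X v) (m : Fin n) (s : ℝ)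
    (t : S.times) : hM.isGaussianSpace.cov (hM.brownianElem m s) (hM.noiseElem t) = 0 := by
  have h1 : IndepFun (W m s.toNNReal) (v t) μ :=
    hM.indep_W_v.comp (φ := fun w : Fin n → ℝ≥0 → ℝ => w m s.toNNReal)
      (ψ := fun z : S.times → ℝ => z t) (by fun_prop) (by fun_prop)
  have h2 := h1.integral_mul_eq_mul_integral
    (hM.measurable_W m _ s.toNNReal.2).aestronglyMeasurable
    (hM.measurable_v t t.2).aestronglyMeasurable
  rw [hM.integral_W, zero_mul] at h2
  exact h2

theorem cov_noise (hM : IsClockModel μ α ε S W X v) (s t : S.times) :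
    hM.isGaussianSpace.cov (hM.noiseElem s) (hM.noiseElem t)
      = if s = t then (S.variance s : ℝ) else 0 := by
  split_ifs with h
  · subst h
    exact integral_mul_self_of_hasLaw (hM.noise_law s s.2)
  · have h2 := (hM.indep_v.indepFun h).integral_mul_eq_mul_integral
      (hM.measurable_v s s.2).aestronglyMeasurable
      (hM.measurable_v t t.2).aestronglyMeasurable
    rw [hM.integral_v, zero_mul] at h2
    exact h2

theorem cov_brownian_increments (hM : IsClockModel μ α ε S W X v) (m l : Fin n)
    {a b c d : ℝ} (ha : 0 ≤ a) (hb : 0 ≤ b) (hc : 0 ≤ c) (hd : 0 ≤ d) :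
    hM.isGaussianSpace.cov (hM.brownianElem m b - hM.brownianElem m a)
        (hM.brownianElem l d - hM.brownianElem l c)
      = if m = l then min b d - min b c - min a d + min a c else 0 := by
  simp only [map_sub, LinearMap.sub_apply, cov_brownian, NNReal.coe_min,
    Real.coe_toNNReal _ ha, Real.coe_toNNReal _ hb, Real.coe_toNNReal _ hc, Real.coe_toNNReal _ hd]
  split_ifs <;> ring

/-- Brownian increments over `[s, t]` are uncorrelated with those over `[0, r]`, as the intervals do
not overlap. -/
theorem cov_gridIncrement_past (hM : IsClockModel μ α ε S W X v) (m l : Fin n) {r s t : ℝ}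
    (hr : 0 ≤ r) (hrs : r ≤ s) (hst : s ≤ t) (N : ℕ) :
    hM.isGaussianSpace.cov (hM.gridIncrement m s t N) (hM.gridIncrement l 0 r N) = 0 := by
  simp only [gridIncrement, map_sum, map_smul, LinearMap.sum_apply, LinearMap.smul_apply]
  refine Finset.sum_eq_zero fun j hj => ?_
  rw [Finset.sum_eq_zero fun k hk => ?_, smul_zero]
  have hk := Finset.mem_range.1 hk
  have hj := Finset.mem_range.1 hj
  have k1 := gridPoint_mem hst hk.le
  have k2 := gridPoint_mem hst (Nat.succ_le_of_lt hk)
  have j1 := gridPoint_mem hr hj.le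
  have j2 := gridPoint_mem hr (Nat.succ_le_of_lt hj)
  simp only [Nat.succ_eq_add_one] at k2 j2
  have hs0 := hr.trans hrs
  rw [hM.cov_brownian_increments _ _ (hs0.trans k1.1) (hs0.trans k2.1) j1.1 j2.1,
    min_eq_right (j2.2.trans (hrs.trans k2.1)), min_eq_right (j1.2.trans (hrs.trans k2.1)),
    min_eq_right (j2.2.trans (hrs.trans k1.1)), min_eq_right (j1.2.trans (hrs.trans k1.1))]
  simp

/-- Only equal cells of the same clock correlate, so the double sum collapses to its diagonal. -/
theorem cov_gridIncrement_self (hM : IsClockModel μ α ε S W X v) (m l : Fin n) {s t : ℝ}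
    (hs : 0 ≤ s) (hst : s ≤ t) (N : ℕ) :
    hM.isGaussianSpace.cov (hM.gridIncrement m s t N) (hM.gridIncrement l s t N)
      = if m = l then ε m ^ 2 * ∑ k ∈ Finset.range (N + 1),
          Real.exp (2 * α * gridPoint s t N k) * (gridPoint s t N (k + 1) - gridPoint s t N k)
        else 0 := by
  have hg : ∀ k ∈ Finset.range (N + 2), 0 ≤ gridPoint s t N k := fun k hk =>
    hs.trans (gridPoint_mem hst (Nat.lt_succ_iff.1 (Finset.mem_range.1 hk))).1
  have hinc : ∀ j ∈ Finset.range (N + 1), ∀ k ∈ Finset.range (N + 1),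
      hM.isGaussianSpace.cov
        (hM.brownianElem m (gridPoint s t N (k + 1)) - hM.brownianElem m (gridPoint s t N k))
        (hM.brownianElem l (gridPoint s t N (j + 1)) - hM.brownianElem l (gridPoint s t N j))
      = if k = j then (if m = l then gridPoint s t N (k + 1) - gridPoint s t N k else 0)
        else 0 := by
    intro j hj k hk
    have hj := Finset.mem_range.1 hj
    have hk := Finset.mem_range.1 hk
    rw [hM.cov_brownian_increments _ _ (hg k (Finset.mem_range.2 (by omega)))
      (hg _ (Finset.mem_range.2 (by omega))) (hg j (Finset.mem_range.2 (by omega)))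
      (hg _ (Finset.mem_range.2 (by omega)))]
    have hmono := gridPoint_mono hst N
    rcases lt_trichotomy k j with h | rfl | h
    · rw [if_neg h.ne, min_eq_left (hmono (by omega : k + 1 ≤ j + 1)),
        min_eq_left (hmono (by omega : k + 1 ≤ j)), min_eq_left (hmono (by omega : k ≤ j + 1)),
        min_eq_left (hmono h.le)]
      simp
    · rw [if_pos rfl, min_self, min_self, min_eq_right (hmono (Nat.le_succ k)),
        min_eq_left (hmono (Nat.le_succ k))]
      split_ifs <;> ring
    · rw [if_neg h.ne', min_eq_right (hmono (by omega : j + 1 ≤ k + 1)),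
        min_eq_right (hmono (by omega : j ≤ k + 1)), min_eq_right (hmono (by omega : j + 1 ≤ k)),
        min_eq_right (hmono h.le)]
      simp
  simp only [gridIncrement, map_sum, map_smul, LinearMap.sum_apply, LinearMap.smul_apply]
  have hsum : ∀ j ∈ Finset.range (N + 1), (Real.exp (α * gridPoint s t N j) * ε l) •
      ∑ k ∈ Finset.range (N + 1), (Real.exp (α * gridPoint s t N k) * ε m) •
        hM.isGaussianSpace.cov
          (hM.brownianElem m (gridPoint s t N (k + 1)) - hM.brownianElem m (gridPoint s t N k))
          (hM.brownianElem l (gridPoint s t N (j + 1)) - hM.brownianElem l (gridPoint s t N j))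
      = if m = l then ε m ^ 2 * (Real.exp (2 * α * gridPoint s t N j)
          * (gridPoint s t N (j + 1) - gridPoint s t N j)) else 0 := by
    intro j hj
    rw [Finset.sum_congr rfl fun k hk => by rw [hinc j hj k hk], Finset.sum_eq_single j
      (fun k _ hkj => by rw [if_neg hkj, smul_zero]) (fun h => absurd hj h), if_pos rfl]
    split_ifs with hml
    · subst hml
      rw [show 2 * α * gridPoint s t N j = α * gridPoint s t N j + α * gridPoint s t N j by ring,
        Real.exp_add]
      simp only [smul_eq_mul]
      ring
    · simp
  rw [Finset.sum_congr rfl hsum]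
  split_ifs
  · rw [Finset.mul_sum]
  · simp

theorem cov_state_noise (hM : IsClockModel μ α ε S W X v) (m : Fin n) {t : ℝ} (ht : 0 ≤ t)
    (s : S.times) : hM.isGaussianSpace.cov (hM.stateElem m t) (hM.noiseElem s) = 0 := by
  have h1 := hM.isGaussianSpace.tendsto_cov (hM.tendsto_gridIncrement_zero m ht)
    (Y' := fun _ => hM.noiseElem s) (Z' := hM.noiseElem s)
    (ae_of_all _ fun _ => tendsto_const_nhds)
  have h2 : ∀ N, hM.isGaussianSpace.cov (hM.gridIncrement m 0 t N) (hM.noiseElem s) = 0 := by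
    intro N
    simp [gridIncrement, map_sum, LinearMap.sum_apply, cov_brownian_noise]
  simp only [h2, map_smul, LinearMap.smul_apply] at h1
  have h3 := tendsto_nhds_unique h1 tendsto_const_nhds
  simpa using h3

/-- The covariances of the discretizations vanish at every mesh, hence so does their limit. -/
theorem cov_fresh_state (hM : IsClockModel μ α ε S W X v) (m l : Fin n) {r s t : ℝ}
    (hr : 0 ≤ r) (hrs : r ≤ s) (hst : s ≤ t) :
    hM.isGaussianSpace.cov (hM.freshElem m s t) (hM.stateElem l r) = 0 := by
  have h1 := hM.isGaussianSpace.tendsto_cov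
    (hM.tendsto_gridIncrement_stateElem m (hr.trans hrs) hst) (hM.tendsto_gridIncrement_zero l hr)
  simp only [hM.cov_gridIncrement_past m l hr hrs hst] at h1
  have h2 := tendsto_nhds_unique tendsto_const_nhds h1
  rw [map_smul, smul_eq_mul, eq_comm, mul_eq_zero] at h2
  rw [freshElem_eq, map_smul, LinearMap.smul_apply, h2.resolve_left (Real.exp_pos _).ne',
    smul_zero]

theorem cov_fresh_noise (hM : IsClockModel μ α ε S W X v) (m : Fin n) {s t : ℝ} (hs : 0 ≤ s)
    (hst : s ≤ t) (u : S.times) :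
    hM.isGaussianSpace.cov (hM.freshElem m s t) (hM.noiseElem u) = 0 := by
  simp [freshElem, hM.cov_state_noise m hs, hM.cov_state_noise m (hs.trans hst)]

/-- Limit of the diagonal sums; the squared weights turn the rate `α` into `2 * α`. -/
theorem cov_fresh_fresh (hM : IsClockModel μ α ε S W X v) (hα : α ≠ 0) (m l : Fin n) {s t : ℝ}
    (hs : 0 ≤ s) (hst : s ≤ t) :
    hM.isGaussianSpace.cov (hM.freshElem m s t) (hM.freshElem l s t)
      = if m = l then gainedVariance α ε (t - s) m else 0 := by
  have h1 := hM.isGaussianSpace.tendsto_cov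
    (hM.tendsto_gridIncrement_stateElem m hs hst) (hM.tendsto_gridIncrement_stateElem l hs hst)
  simp only [hM.cov_gridIncrement_self m l hs hst] at h1
  rw [freshElem_eq, freshElem_eq, map_smul, map_smul, LinearMap.smul_apply]
  split_ifs at h1 ⊢ with hml
  · have h2 := (tendsto_grid_exp (α := 2 * α) (by positivity) hs hst).const_mul (ε m ^ 2)
    rw [tendsto_nhds_unique h1 h2, gainedVariance]
    have h3 : Real.exp (-(2 * α) * (t - s)) = Real.exp (-(α * t)) * Real.exp (-(α * t))
        * Real.exp (2 * α * s) := by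
      rw [← Real.exp_add, ← Real.exp_add]
      ring_nf
    have h4 : Real.exp (-(α * t)) * Real.exp (-(α * t)) * Real.exp (2 * α * t) = 1 := by
      rw [← Real.exp_add, ← Real.exp_add, ← Real.exp_zero]
      ring_nf
    rw [h3]
    simp only [smul_eq_mul]
    linear_combination (ε m ^ 2 / (2 * α)) * h4
  · rw [tendsto_nhds_unique h1 tendsto_const_nhds]
    simp

/-- The initial value vanishes only almost surely, so the state is replaced by `0` inside the
covariance. -/
theorem cov_state_zero (hM : IsClockModel μ α ε S W X v) (m : Fin n)
    (Z : gaussianHull μ S W v) : hM.isGaussianSpace.cov (hM.stateElem m 0) Z = 0 := by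
  rw [hM.isGaussianSpace.cov_congr (Y' := 0) Z ?_]
  · simp
  · rw [hM.coe_stateElem m le_rfl]
    exact hM.ae_X_zero m

end IsClockModel

end Model

/-! ### The filter equations as recursive orthogonal projection -/

section Filter

variable {n : ℕ} {E : Set (Fin (n + 1) × Fin (n + 1))} {Ω : Type*} [MeasurableSpace Ω]
  {μ : Measure Ω} {α : ℝ} {ε : Fin n → ℝ} {S : MeasurementSchedule n E}
  {W X : Fin n → ℝ → Ω → ℝ} {v : ℝ → Ω → ℝ}

namespace IsClockModel

/-- A measurement as an element of the Gaussian space. -/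
noncomputable def obsElem (hM : IsClockModel μ α ε S W X v) (s : S.times) :
    gaussianHull μ S W v :=
  ∑ m, measurementVector (S.link s) m • hM.stateElem m s + hM.noiseElem s

theorem coe_obsElem (hM : IsClockModel μ α ε S W X v) (hE : ∀ e ∈ E, e.1 ≠ e.2) (s : S.times) :
    (hM.obsElem s).1 = measurement S X v s := by
  funext ω
  rw [measurement_eq_dotProduct S X v s ω (hE _ (S.link_mem s s.2))]
  simp [obsElem, noiseElem, dotProduct, hM.coe_stateElem _ (S.nonneg s s.2), Finset.sum_apply]

/-- The linear combinations of the measurements taken at the instants of a set. -/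
noncomputable def obsSpace (hM : IsClockModel μ α ε S W X v) (I : Set ℝ) :
    Submodule ℝ (gaussianHull μ S W v) :=
  Submodule.span ℝ (hM.obsElem '' {s | s.1 ∈ I})

theorem obsSpace_mono (hM : IsClockModel μ α ε S W X v) {I J : Set ℝ} (h : I ⊆ J) :
    hM.obsSpace I ≤ hM.obsSpace J :=
  Submodule.span_mono (Set.image_mono fun _ hs => h hs)

theorem obsElem_mem (hM : IsClockModel μ α ε S W X v) {I : Set ℝ} (s : S.times) (hs : s.1 ∈ I) :
    hM.obsElem s ∈ hM.obsSpace I :=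
  Submodule.subset_span ⟨s, hs, rfl⟩

variable [IsProbabilityMeasure μ]

theorem cov_eq_zero_of_mem_obsSpace (hM : IsClockModel μ α ε S W X v) {I : Set ℝ}
    {Y Z : gaussianHull μ S W v}
    (h : ∀ s : S.times, s.1 ∈ I → hM.isGaussianSpace.cov Y (hM.obsElem s) = 0)
    (hZ : Z ∈ hM.obsSpace I) : hM.isGaussianSpace.cov Y Z = 0 := by
  have hle : hM.obsSpace I ≤ LinearMap.ker (hM.isGaussianSpace.cov Y) := by
    refine Submodule.span_le.2 ?_
    rintro _ ⟨s, hs, rfl⟩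
    exact h s hs
  exact hle hZ

theorem cov_noise_obs (hM : IsClockModel μ α ε S W X v) {s t : S.times} (hst : t ≠ s) :
    hM.isGaussianSpace.cov (hM.noiseElem t) (hM.obsElem s) = 0 := by
  rw [obsElem, map_add, hM.cov_noise, if_neg hst, map_sum]
  rw [Finset.sum_eq_zero fun m _ => ?_, zero_add]
  rw [map_smul, hM.isGaussianSpace.cov_comm, hM.cov_state_noise m (S.nonneg s s.2), smul_zero]

theorem cov_fresh_obs (hM : IsClockModel μ α ε S W X v) (m : Fin n) {s t : ℝ}
    (hst : s ≤ t) (r : S.times) (hr : r.1 ≤ s) :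
    hM.isGaussianSpace.cov (hM.freshElem m s t) (hM.obsElem r) = 0 := by
  have hr0 := S.nonneg r r.2
  rw [obsElem, map_add, hM.cov_fresh_noise m (hr0.trans hr) hst, map_sum]
  rw [Finset.sum_eq_zero fun l _ => ?_, zero_add]
  rw [map_smul, hM.cov_fresh_state m l hr0 hr hst, smul_zero]

/-- `Zh` estimates the state at time `t` linearly from the measurements at the instants of `I`,
with an error that is uncorrelated with these and has covariance `Q`. -/
def IsLinearEstimate (hM : IsClockModel μ α ε S W X v) (I : Set ℝ) (t : ℝ) (Zh : Ω → Fin n → ℝ)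
    (Q : Matrix (Fin n) (Fin n) ℝ) : Prop :=
  ∃ z : Fin n → gaussianHull μ S W v, (∀ m, (z m).1 = fun ω => Zh ω m) ∧
    (∀ m, z m ∈ hM.obsSpace I) ∧
    (∀ m l, hM.isGaussianSpace.cov (hM.stateElem m t - z m) (hM.stateElem l t - z l) = Q m l) ∧
    ∀ m (s : S.times), s.1 ∈ I →
      hM.isGaussianSpace.cov (hM.stateElem m t - z m) (hM.obsElem s) = 0

theorem IsLinearEstimate.init (hM : IsClockModel μ α ε S W X v) {I : Set ℝ}
    (hI : I ∩ S.times = ∅) : hM.IsLinearEstimate I 0 0 0 := by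
  refine ⟨0, fun m => rfl, fun m => Submodule.zero_mem _, fun m l => ?_, fun m s hs => ?_⟩
  · simp [hM.cov_state_zero]
  · have : s.1 ∈ I ∩ S.times := ⟨hs, s.2⟩
    simp [hI] at this

/-- The new error is the damped old error plus the fresh part of the state. The latter is
uncorrelated with the states and measurements up to `s`, so no cross terms appear. -/
theorem IsLinearEstimate.flow {hM : IsClockModel μ α ε S W X v} (hα : α ≠ 0) {I : Set ℝ}
    {s t : ℝ} {Zh Zh' : Ω → Fin n → ℝ} {Q Q' : Matrix (Fin n) (Fin n) ℝ} (hs : 0 ≤ s)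
    (hst : s ≤ t) (hI : ∀ u ∈ I, u ≤ s) (h : hM.IsLinearEstimate I s Zh Q)
    (hZ : ∀ ω m, Zh' ω m = Real.exp (-α * (t - s)) * Zh ω m)
    (hQ : ∀ m l, Q' m l = Real.exp (-(2 * α) * (t - s)) * Q m l
      + if m = l then gainedVariance α ε (t - s) m else 0) :
    hM.IsLinearEstimate I t Zh' Q' := by
  obtain ⟨z, hz, hmem, hcov, horth⟩ := h
  set c := Real.exp (-α * (t - s)) with hc
  have herr : ∀ m, hM.stateElem m t - c • z m
      = c • (hM.stateElem m s - z m) + hM.freshElem m s t := by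
    intro m
    rw [freshElem]
    module
  have hfz : ∀ m, ∀ Z ∈ hM.obsSpace I, hM.isGaussianSpace.cov (hM.freshElem m s t) Z = 0 :=
    fun m Z hZ => hM.cov_eq_zero_of_mem_obsSpace
      (fun r hr => hM.cov_fresh_obs m hst r (hI _ hr)) hZ
  have hfe : ∀ m l,
      hM.isGaussianSpace.cov (hM.freshElem m s t) (hM.stateElem l s - z l) = 0 := by
    intro m l
    rw [map_sub, hM.cov_fresh_state m l hs le_rfl hst, hfz m _ (hmem l), sub_zero]
  refine ⟨fun m => c • z m, fun m => ?_, fun m => Submodule.smul_mem _ _ (hmem m),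
    fun m l => ?_, fun m r hr => ?_⟩
  · funext ω
    rw [hZ, Submodule.coe_smul, hz]
    rfl
  · rw [herr, herr, hQ]
    simp only [map_add, map_smul, LinearMap.add_apply, LinearMap.smul_apply, hfe, hcov,
      hM.isGaussianSpace.cov_comm (hM.stateElem m s - z m) (hM.freshElem l s t),
      hM.cov_fresh_fresh hα m l hs hst, smul_eq_mul]
    have : Real.exp (-(2 * α) * (t - s)) = c * c := by
      rw [hc, ← Real.exp_add]
      ring_nf
    rw [this]
    ring
  · rw [herr, map_add, LinearMap.add_apply, map_smul, LinearMap.smul_apply, horth m r hr,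
      hfz m _ (hM.obsElem_mem r hr)]
    simp

/-- Gram-Schmidt: the innovation is the part of the new measurement uncorrelated with the earlier
ones, and the gain is the regression coefficient of the error on it. -/
theorem IsLinearEstimate.jump {hM : IsClockModel μ α ε S W X v} (hE : ∀ e ∈ E, e.1 ≠ e.2)
    {t : S.times} {Zh Zh' : Ω → Fin n → ℝ} {Q : Matrix (Fin n) (Fin n) ℝ}
    (h : hM.IsLinearEstimate (S.times ∩ Set.Iio t) t Zh Q)
    (hZ : ∀ ω, Zh' ω
      = estimateUpdate Q (S.link t) (S.variance t) (measurement S X v t ω) (Zh ω)) :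
    hM.IsLinearEstimate (S.times ∩ Set.Iic t) t Zh'
      (covarianceUpdate (S.link t) (S.variance t) Q) := by
  obtain ⟨z, hz, hmem, hcov, horth⟩ := h
  have ht0 := S.nonneg t t.2
  have hne := hE _ (S.link_mem t t.2)
  have hσ : (0 : ℝ) < S.variance t := S.variance_pos t t.2
  set B := hM.isGaussianSpace.cov with hB
  have hcomm : ∀ Y Z, B Y Z = B Z Y := hM.isGaussianSpace.cov_comm
  set e : Fin n → gaussianHull μ S W v := fun m => hM.stateElem m t - z m with he
  set a : Fin n → ℝ := measurementVector (S.link t) with ha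
  set η := hM.noiseElem t with hη
  have hee : ∀ m l, B (e m) (e l) = Q m l := hcov
  have hsym : ∀ m l, Q m l = Q l m := fun m l => by rw [← hcov, ← hcov, hcomm]
  have hηz : ∀ Z ∈ hM.obsSpace (S.times ∩ Set.Iio t), B η Z = 0 := fun Z hZ =>
    hM.cov_eq_zero_of_mem_obsSpace
      (fun s hs => hM.cov_noise_obs fun h => (Set.mem_Iio.1 hs.2).ne (congrArg _ h.symm)) hZ
  have heη : ∀ m, B (e m) η = 0 := by
    intro m
    rw [he, map_sub, LinearMap.sub_apply, hM.cov_state_noise m ht0, hcomm, hηz _ (hmem m),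
      sub_zero]
  -- The innovation: the measurement minus its prediction, expressed through the errors and the new
  -- noise.
  set ν := ∑ i, a i • e i + η with hν
  have hobs : hM.obsElem t = ν + ∑ i, a i • z i := by
    simp only [hν, he, obsElem, smul_sub, Finset.sum_sub_distrib]
    abel
  have heν : ∀ m, B (e m) ν = linkCov Q (S.link t) m := by
    intro m
    simp only [hν, map_add, map_sum, map_smul, heη, add_zero, linkCov, dotProduct, smul_eq_mul]
    exact Finset.sum_congr rfl fun i _ => by rw [hcov]
  have hνν : B ν ν = innovationVariance Q (S.link t) (S.variance t) := by
    have h1 : B ν ν = ∑ i, a i * B (e i) ν + B η ν := by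
      conv_lhs => rw [hν]
      simp [LinearMap.add_apply, LinearMap.sum_apply, hν]
    have h2 : B η ν = S.variance t := by
      simp only [hν, map_add, map_sum, map_smul, hcomm η (e _), heη, smul_zero,
        Finset.sum_const_zero, zero_add]
      rw [hB, hη, hM.cov_noise, if_pos rfl]
    rw [h1, h2, innovationVariance_eq hne hsym]
    simp only [heν]
    rfl
  set c := innovationVariance Q (S.link t) (S.variance t) with hc
  -- The new noise is uncorrelated with the errors, so it contributes its whole variance.
  have hcpos : 0 < c := by
    have h1 : 0 ≤ B (∑ i, a i • e i) (∑ i, a i • e i) := hM.isGaussianSpace.cov_self_nonneg _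
    have h2 : B (∑ i, a i • e i) η = 0 := by
      simp [LinearMap.sum_apply, heη]
    have h3 : B η η = S.variance t := by rw [hB, hη, hM.cov_noise, if_pos rfl]
    rw [← hνν, hν]
    simp only [map_add, LinearMap.add_apply] at h1 ⊢
    rw [hcomm η, h2, h3]
    linarith
  set k : Fin n → ℝ := fun m => linkCov Q (S.link t) m / c with hk
  have herr : ∀ m, hM.stateElem m t - (z m + k m • ν) = e m - k m • ν := fun m => by
    simp only [he]
    abel
  refine ⟨fun m => z m + k m • ν, fun m => ?_, fun m => ?_, fun m l => ?_, fun m s hs => ?_⟩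
  · have hνcoe : ν.1 = fun ω => measurement S X v t ω - a ⬝ᵥ Zh ω := by
      have h1 : ν = hM.obsElem t - ∑ i, a i • z i := by rw [hobs, add_sub_cancel_right]
      funext ω
      rw [h1]
      simp [hM.coe_obsElem hE, Finset.sum_apply, hz, dotProduct]
    funext ω
    rw [hZ, estimateUpdate_eq hne, Submodule.coe_add, Submodule.coe_smul, hνcoe, hz]
    rfl
  · have hz' : ∀ i, z i ∈ hM.obsSpace (S.times ∩ Set.Iic t) := fun i =>
      hM.obsSpace_mono (Set.inter_subset_inter_right _ Set.Iio_subset_Iic_self) (hmem i)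
    refine Submodule.add_mem _ (hz' m) (Submodule.smul_mem _ _ ?_)
    rw [show ν = hM.obsElem t - ∑ i, a i • z i by rw [hobs, add_sub_cancel_right]]
    exact Submodule.sub_mem _ (hM.obsElem_mem t ⟨t.2, Set.mem_Iic.2 le_rfl⟩)
      (Submodule.sum_mem _ fun i _ => Submodule.smul_mem _ _ (hz' i))
  · rw [herr, herr, covarianceUpdate_eq hne hsym, ← hB, ← hc]
    simp only [map_sub, map_smul, LinearMap.sub_apply, LinearMap.smul_apply, smul_eq_mul,
      hcomm ν (e _), heν, hνν, hee, hk]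
    field_simp
    ring
  · have horth' : ∀ s : S.times, s.1 ∈ S.times ∩ Set.Iio t.1 →
        B (e m - k m • ν) (hM.obsElem s) = 0 := by
      intro s hs
      have h1 : B ν (hM.obsElem s) = 0 := by
        rw [hν, map_add, LinearMap.add_apply, hηz _ (hM.obsElem_mem s hs), map_sum,
          LinearMap.sum_apply, add_zero]
        exact Finset.sum_eq_zero fun i _ => by
          rw [map_smul, LinearMap.smul_apply, horth i s hs, smul_zero]
      rw [map_sub, LinearMap.sub_apply, map_smul, LinearMap.smul_apply, h1, horth m s hs]
      simp
    rw [herr]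
    -- At the current instant the measurement splits into the innovation, orthogonal by the choice
    -- of gain, and a prediction in the span of the earlier measurements.
    rcases (show s.1 ≤ t.1 from hs.2).eq_or_lt with hst | hst
    · obtain rfl : s = t := Subtype.ext hst
      have h1 : B (e m - k m • ν) (∑ i, a i • z i) = 0 :=
        hM.cov_eq_zero_of_mem_obsSpace horth'
          (Submodule.sum_mem _ fun i _ => Submodule.smul_mem _ _ (hmem i))
      rw [hobs, map_add, h1, map_sub, LinearMap.sub_apply, map_smul, LinearMap.smul_apply, heν,
        hνν, smul_eq_mul, hk]
      field_simp
      ring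
    · exact horth' s ⟨hs.1, hst⟩

theorem isLinearEstimate_filter (hM : IsClockModel μ α ε S W X v) (hα : 0 < α)
    (hE : ∀ e ∈ E, e.1 ≠ e.2) {Xh Xhm : ℝ → Ω → Fin n → ℝ}
    {P Pm : ℝ → Matrix (Fin n) (Fin n) ℝ}
    (hF : IsKalmanBucyFilter α ε S (measurement S X v) Xh Xhm P Pm) :
    ∀ t, 0 ≤ t → hM.IsLinearEstimate (S.times ∩ Set.Iio t) t (Xhm t) (Pm t) ∧
      hM.IsLinearEstimate (S.times ∩ Set.Iic t) t (Xh t) (P t) := by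
  refine impulsive_induction S.locallyFinite ?_ ?_ ?_
  · have h1 : Xhm 0 = 0 := funext fun ω => (hF.estimate ω).init
    rw [h1, hF.covariance.init]
    refine IsLinearEstimate.init hM (Set.eq_empty_of_forall_notMem ?_)
    rintro u ⟨⟨hu, hu0⟩, -⟩
    exact absurd (S.nonneg u hu) (not_le.2 hu0)
  · intro t ht h
    by_cases htT : t ∈ S.times
    · rw [hF.covariance.jump t ht htT]
      exact IsLinearEstimate.jump (t := ⟨t, htT⟩) hE h fun ω => (hF.estimate ω).jump t ht htT
    · have h1 : Xh t = Xhm t := funext fun ω => (hF.estimate ω).noJump t ht htT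
      have h2 : S.times ∩ Set.Iic t = S.times ∩ Set.Iio t := by
        ext u
        refine and_congr_right fun hu => ⟨fun h => Set.mem_Iio.2 (lt_of_le_of_ne h ?_),
          fun h => (Set.mem_Iio.1 h).le⟩
        rintro rfl
        exact htT hu
      rw [h1, h2, hF.covariance.noJump t ht htT]
      exact h
  · intro s t hs hst hT h
    have h2 : S.times ∩ Set.Iio t = S.times ∩ Set.Iic s := by
      ext u
      refine and_congr_right fun hu => ⟨fun h => ?_, fun h => Set.mem_Iio.2 (lt_of_le_of_lt h hst)⟩
      by_contra hus
      exact hT u ⟨not_le.1 hus, h⟩ hu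
    rw [h2]
    exact h.flow hα.ne' hs hst.le (fun u hu => hu.2)
      (fun ω m => (hF.estimate ω).decay_flow hα.ne' hs hst hT m)
      (IsCovarianceFlow.flow hα hF.covariance hs hst hT)

end IsClockModel

end Filter

/-! ### From uncorrelated errors to optimality and bounds -/

theorem observed_eq_comap {Ω : Type*} (y : ℝ → Ω → ℝ) (I : Set ℝ) :
    observed y I = MeasurableSpace.comap (fun ω (s : I) => y s ω) MeasurableSpace.pi := by
  rw [observed, MeasurableSpace.pi, MeasurableSpace.comap_iSup, iSup_subtype']
  refine iSup_congr fun s => ?_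
  rw [MeasurableSpace.comap_comp, ← BorelSpace.measurable_eq]
  rfl

section Optimality

variable {n : ℕ} {E : Set (Fin (n + 1) × Fin (n + 1))} {Ω : Type*} [mΩ : MeasurableSpace Ω]
  {μ : Measure Ω} {α : ℝ} {ε : Fin n → ℝ} {S : MeasurementSchedule n E}
  {W X : Fin n → ℝ → Ω → ℝ} {v : ℝ → Ω → ℝ}

namespace IsClockModel

theorem measurable_measurement (hM : IsClockModel μ α ε S W X v) (hE : ∀ e ∈ E, e.1 ≠ e.2)
    {s : ℝ} (hs : s ∈ S.times) : Measurable (measurement S X v s) := by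
  have h : measurement S X v s = fun ω =>
      measurementVector (S.link s) ⬝ᵥ (fun m => X m s ω) + v s ω := funext fun ω =>
    measurement_eq_dotProduct S X v s ω (hE _ (S.link_mem s hs))
  rw [h]
  refine Measurable.add ?_ (hM.measurable_v s hs)
  exact Finset.measurable_sum _ fun m _ => (hM.measurable_X m s (S.nonneg s hs)).const_mul _

theorem observed_le (hM : IsClockModel μ α ε S W X v) (hE : ∀ e ∈ E, e.1 ≠ e.2) {I : Set ℝ}
    (hI : I ⊆ S.times) : observed (measurement S X v) I ≤ mΩ :=
  iSup₂_le fun s hs => by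
    rw [← BorelSpace.measurable_eq]
    exact (hM.measurable_measurement hE (hI hs)).comap_le

theorem measurable_of_mem_obsSpace (hM : IsClockModel μ α ε S W X v) (hE : ∀ e ∈ E, e.1 ≠ e.2)
    {I : Set ℝ} {Z : gaussianHull μ S W v} (hZ : Z ∈ hM.obsSpace I) :
    Measurable[observed (measurement S X v) I] Z.1 := by
  induction hZ using Submodule.span_induction with
  | mem Z hZ =>
    obtain ⟨s, hs, rfl⟩ := hZ
    rw [hM.coe_obsElem hE, BorelSpace.measurable_eq (α := ℝ)]
    exact measurable_iff_comap_le.2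
      (le_iSup₂ (f := fun s (_ : s ∈ I) => MeasurableSpace.comap (measurement S X v s) (borel ℝ))
        s.1 hs)
  | zero => exact @measurable_const _ _ _ (observed (measurement S X v) I) 0
  | add Y Z _ _ hY hZ => exact hY.add hZ
  | smul c Z _ hZ => exact hZ.const_smul c

variable [IsProbabilityMeasure μ]

/-- The estimation error at a linear estimate is independent of the observations. -/
theorem indep_error (hM : IsClockModel μ α ε S W X v) (hE : ∀ e ∈ E, e.1 ≠ e.2) {I : Set ℝ}
    (hI : I ⊆ S.times) (e : Fin n → gaussianHull μ S W v)
    (horth : ∀ m (s : S.times), s.1 ∈ I → hM.isGaussianSpace.cov (e m) (hM.obsElem s) = 0) :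
    Indep (MeasurableSpace.comap (fun ω m => (e m).1 ω) MeasurableSpace.pi)
      (observed (measurement S X v) I) μ := by
  have h := hM.isGaussianSpace.indepFun e (fun s : I => hM.obsElem ⟨s, hI s.2⟩)
    fun m s => horth m _ s.2
  rw [observed_eq_comap]
  simp only [hM.coe_obsElem hE] at h
  exact h

namespace IsLinearEstimate

variable {hM : IsClockModel μ α ε S W X v} {I : Set ℝ} {t : ℝ} {Zh : Ω → Fin n → ℝ}
  {Q : Matrix (Fin n) (Fin n) ℝ}

theorem errorCov_eq (h : hM.IsLinearEstimate I t Zh Q) (ht : 0 ≤ t) :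
    errorCov μ (fun ω m => X m t ω) Zh = Q := by
  obtain ⟨z, hz, -, hcov, -⟩ := h
  funext m l
  rw [← hcov m l, IsGaussianSpace.cov_apply, errorCov]
  simp [hM.coe_stateElem _ ht, hz]

/-- Products of errors are functions of the error vector, which is independent of the observations,
so conditioning returns their mean. -/
theorem condErrorCov_eq (h : hM.IsLinearEstimate I t Zh Q) (hE : ∀ e ∈ E, e.1 ≠ e.2)
    (hI : I ⊆ S.times) (ht : 0 ≤ t) (m l : Fin n) :
    condErrorCov μ (observed (measurement S X v) I) (fun ω m => X m t ω) Zh m l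
      =ᵐ[μ] fun _ => errorCov μ (fun ω m => X m t ω) Zh m l := by
  obtain ⟨z, hz, hmem, -, horth⟩ := h
  have hle := hM.observed_le hE hI
  have herr : ∀ m, (hM.stateElem m t - z m).1 = fun ω => X m t ω - Zh ω m := fun m => by
    rw [Submodule.coe_sub, hM.coe_stateElem m ht, hz]
    rfl
  have hind := hM.indep_error hE hI _ horth
  simp only [herr] at hind
  have hmeas : Measurable fun ω m => X m t ω - Zh ω m := measurable_pi_lambda _ fun m =>
    (hM.measurable_X m t ht).sub (hz m ▸ (hM.measurable_of_mem_obsSpace hE (hmem m)).mono hle le_rfl)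
  refine condExp_indep_eq hmeas.comap_le hle ?_ hind
  refine Measurable.stronglyMeasurable ?_
  have hc := comap_measurable (m := MeasurableSpace.pi) (fun ω m => X m t ω - Zh ω m)
  exact ((measurable_pi_apply m).comp hc).mul ((measurable_pi_apply l).comp hc)

theorem isOptimalEstimate (h : hM.IsLinearEstimate I t Zh Q) (hE : ∀ e ∈ E, e.1 ≠ e.2)
    (hI : I ⊆ S.times) (ht : 0 ≤ t) :
    IsOptimalEstimate μ (observed (measurement S X v) I) (fun ω m => X m t ω) Zh := by
  obtain ⟨z, hz, hmem, -, horth⟩ := h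
  have hle := hM.observed_le hE hI
  have herr : ∀ m, (hM.stateElem m t - z m).1 = fun ω => X m t ω - Zh ω m := fun m => by
    rw [Submodule.coe_sub, hM.coe_stateElem m ht, hz]
    rfl
  have hind := hM.indep_error hE hI _ horth
  simp only [herr] at hind
  have hZm : ∀ m, Measurable[observed (measurement S X v) I] fun ω => Zh ω m := fun m =>
    hz m ▸ hM.measurable_of_mem_obsSpace hE (hmem m)
  have hmeas : Measurable fun ω m => X m t ω - Zh ω m := measurable_pi_lambda _ fun m =>
    (hM.measurable_X m t ht).sub ((hZm m).mono hle le_rfl)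
  have hX2 : ∀ m, MemLp (X m t) 2 μ := fun m =>
    hM.isGaussianSpace.memLp (hM.X_mem_gaussianHull m ht)
  have hZ2 : ∀ m, MemLp (fun ω => Zh ω m) 2 μ := fun m =>
    hz m ▸ hM.isGaussianSpace.memLp (z m).2
  have he0 : ∀ m, ∫ ω, (X m t ω - Zh ω m) ∂μ = 0 := fun m => by
    have := hM.isGaussianSpace.integral_eq_zero (hM.stateElem m t - z m).2
    rwa [herr] at this
  have hc := comap_measurable (m := MeasurableSpace.pi) (fun ω m => X m t ω - Zh ω m)
  refine ⟨hle, hZm, hX2, hZ2, fun m => ?_, fun U hU hU2 => ?_⟩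
  -- The error is centred and independent of the observations, so its conditional mean is zero.
  · have h1 : μ[fun ω => X m t ω - Zh ω m | observed (measurement S X v) I] =ᵐ[μ] fun _ => 0 := by
      have h2 := condExp_indep_eq hmeas.comap_le hle
        (f := fun ω => X m t ω - Zh ω m)
        (Measurable.stronglyMeasurable ((measurable_pi_apply m).comp hc)) hind
      rwa [he0] at h2
    have h3 := condExp_sub ((hX2 m).integrable one_le_two) ((hZ2 m).integrable one_le_two)
      (observed (measurement S X v) I)
    have h4 : μ[fun ω => Zh ω m | observed (measurement S X v) I] = fun ω => Zh ω m :=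
      condExp_of_stronglyMeasurable hle (hZm m).stronglyMeasurable
        ((hZ2 m).integrable one_le_two)
    filter_upwards [h1, h3] with ω hω1 hω3
    have h5 : (μ[fun ω => X m t ω - Zh ω m | observed (measurement S X v) I]) ω
        = (μ[X m t | observed (measurement S X v) I]) ω - Zh ω m := by
      rw [← congrFun h4 ω]
      exact hω3
    rw [hω1] at h5
    change Zh ω m = (μ[X m t | observed (measurement S X v) I]) ω
    linarith
  · have hE2 : ∀ m, MemLp (fun ω => X m t ω - Zh ω m) 2 μ := fun m => (hX2 m).sub (hZ2 m)
    have hD2 : ∀ m, MemLp (fun ω => Zh ω m - U ω m) 2 μ := fun m => (hZ2 m).sub (hU2 m)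
    have hXU2 : ∀ m, MemLp (fun ω => X m t ω - U ω m) 2 μ := fun m => (hX2 m).sub (hU2 m)
    rw [integral_finsetSum _ fun m _ => (hE2 m).integrable_sq,
      integral_finsetSum _ fun m _ => (hXU2 m).integrable_sq]
    refine Finset.sum_le_sum fun m _ => ?_
    -- Pythagoras: the difference of two observable estimates is independent of the centred error,
    -- so the cross term integrates to zero.
    have hIF : IndepFun (fun ω => X m t ω - Zh ω m) (fun ω => Zh ω m - U ω m) μ := by
      refine (IndepFun_iff_Indep _ _ _).2 (indep_of_indep_of_le_left
        (indep_of_indep_of_le_right hind ?_) ?_)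
      · exact ((hZm m).sub (hU m)).comap_le
      · exact ((measurable_pi_apply m).comp hc).comap_le
    have hcross : ∫ ω, (X m t ω - Zh ω m) * (Zh ω m - U ω m) ∂μ = 0 := by
      have := hIF.integral_mul_eq_mul_integral (hE2 m).aestronglyMeasurable
        (hD2 m).aestronglyMeasurable
      rw [he0, zero_mul] at this
      exact this
    have hexp : ∀ ω, (X m t ω - U ω m) ^ 2 = (X m t ω - Zh ω m) ^ 2
        + 2 * ((X m t ω - Zh ω m) * (Zh ω m - U ω m)) + (Zh ω m - U ω m) ^ 2 := fun ω => by ring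
    have hi : Integrable (fun ω => 2 * ((X m t ω - Zh ω m) * (Zh ω m - U ω m))) μ :=
      ((hE2 m).integrable_mul (hD2 m)).const_mul 2
    simp only [hexp]
    have hi' : Integrable (fun ω => (X m t ω - Zh ω m) ^ 2
        + 2 * ((X m t ω - Zh ω m) * (Zh ω m - U ω m))) μ := (hE2 m).integrable_sq.add hi
    rw [integral_add hi' (hD2 m).integrable_sq,
      integral_add (hE2 m).integrable_sq hi, integral_const_mul, hcross]
    have : 0 ≤ ∫ ω, (Zh ω m - U ω m) ^ 2 ∂μ := integral_nonneg fun _ => sq_nonneg _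
    linarith

/-- The estimate and its error are uncorrelated, so the error variance is at most that of the state.
Off the diagonal, nonnegativity of the variances of `e m ± e l` bounds the covariance by the mean of
two diagonal entries. -/
theorem abs_covariance_le (h : hM.IsLinearEstimate I t Zh Q) (hα : 0 < α) (ht : 0 ≤ t) (m l : Fin n) :
    |Q m l| ≤ ∑ i, ε i ^ 2 / (2 * α) := by
  obtain ⟨z, -, hmem, hcov, horth⟩ := h
  set e : Fin n → gaussianHull μ S W v := fun m => hM.stateElem m t - z m with he
  have hee : ∀ m l, hM.isGaussianSpace.cov (e m) (e l) = Q m l := hcov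
  have hdiag : ∀ m, Q m m ≤ ε m ^ 2 / (2 * α) := by
    intro m
    have hez : hM.isGaussianSpace.cov (e m) (z m) = 0 :=
      hM.cov_eq_zero_of_mem_obsSpace (horth m) (hmem m)
    have hfe : hM.stateElem m t = e m + z m := by simp [he]
    have h1 : hM.isGaussianSpace.cov (hM.stateElem m t) (hM.stateElem m t)
        = Q m m + hM.isGaussianSpace.cov (z m) (z m) := by
      rw [hfe]
      simp only [map_add, LinearMap.add_apply, hM.isGaussianSpace.cov_comm (z m) (e m), hez, hee]
      ring
    -- Started at time `0` from the value zero, the whole state is fresh; this gives its variance.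
    have h2 := hM.cov_fresh_fresh hα.ne' m m le_rfl ht
    have h3 : hM.isGaussianSpace.cov (hM.freshElem m 0 t) (hM.freshElem m 0 t)
        = hM.isGaussianSpace.cov (hM.stateElem m t) (hM.stateElem m t) := by
      simp only [freshElem, map_sub, map_smul, LinearMap.sub_apply, LinearMap.smul_apply,
        hM.cov_state_zero, hM.isGaussianSpace.cov_comm _ (hM.stateElem m 0)]
      simp
    rw [if_pos rfl, h3, h1, gainedVariance] at h2
    have h4 := hM.isGaussianSpace.cov_self_nonneg (z m)
    have h5 : ε m ^ 2 * (1 - Real.exp (-(2 * α) * (t - 0))) / (2 * α) ≤ ε m ^ 2 / (2 * α) := by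
      refine div_le_div_of_nonneg_right ?_ (by positivity)
      have := (Real.exp_pos (-(2 * α) * (t - 0))).le
      nlinarith [sq_nonneg (ε m)]
    linarith
  have hB : ∀ m, Q m m ≤ ∑ i, ε i ^ 2 / (2 * α) := fun m => (hdiag m).trans
    (Finset.single_le_sum (f := fun i => ε i ^ 2 / (2 * α)) (fun i _ => by positivity)
      (Finset.mem_univ m))
  have hsym : Q l m = Q m l := by rw [← hee, ← hee, hM.isGaussianSpace.cov_comm]
  have h1 := hM.isGaussianSpace.cov_self_nonneg (e m + e l)
  have h2 := hM.isGaussianSpace.cov_self_nonneg (e m - e l)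
  simp only [map_add, map_sub, LinearMap.add_apply, LinearMap.sub_apply, hee, hsym] at h1 h2
  have h3 := hB m
  have h4 := hB l
  rw [abs_le]
  constructor <;> linarith

end IsLinearEstimate

end IsClockModel

end Optimality

end ClockNetwork

theorem mainTheorem6 {n : ℕ} {Ω : Type*} [MeasurableSpace Ω] (μ : Measure Ω)
    [IsProbabilityMeasure μ] (α : ℝ) (hα : 0 < α) (ε : Fin n → ℝ) (hε : ∀ m, 0 < ε m)
    (E : Set (Fin (n + 1) × Fin (n + 1))) (hE : ∀ e ∈ E, e.1 ≠ e.2)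
    (S : ClockNetwork.MeasurementSchedule n E)
    (W X : Fin n → ℝ → Ω → ℝ) (v : ℝ → Ω → ℝ)
    (hmodel : ClockNetwork.IsClockModel μ α ε S W X v) :
    (∃ (Xh Xhm : ℝ → Ω → Fin n → ℝ) (P Pm : ℝ → Matrix (Fin n) (Fin n) ℝ),
      ClockNetwork.IsKalmanBucyFilter α ε S (ClockNetwork.measurement S X v) Xh Xhm P Pm) ∧
    ∀ (Xh Xhm : ℝ → Ω → Fin n → ℝ) (P Pm : ℝ → Matrix (Fin n) (Fin n) ℝ),
      ClockNetwork.IsKalmanBucyFilter α ε S (ClockNetwork.measurement S X v) Xh Xhm P Pm →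
      -- optimality, after and before a possible measurement at time `t`
      (∀ t : ℝ, 0 ≤ t →
        ClockNetwork.IsOptimalEstimate μ
          (ClockNetwork.observed (ClockNetwork.measurement S X v) (S.times ∩ Set.Iic t))
          (fun ω m => X m t ω) (Xh t) ∧
        ClockNetwork.IsOptimalEstimate μ
          (ClockNetwork.observed (ClockNetwork.measurement S X v) (S.times ∩ Set.Iio t))
          (fun ω m => X m t ω) (Xhm t)) ∧
      -- conditional and unconditional error covariances coincide, and are given by the filter
      (∀ t : ℝ, 0 ≤ t → ∀ m l : Fin n,
        ClockNetwork.condErrorCov μ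
            (ClockNetwork.observed (ClockNetwork.measurement S X v) (S.times ∩ Set.Iic t))
            (fun ω m => X m t ω) (Xh t) m l
          =ᵐ[μ] (fun _ => ClockNetwork.errorCov μ (fun ω m => X m t ω) (Xh t) m l) ∧
        ClockNetwork.condErrorCov μ
            (ClockNetwork.observed (ClockNetwork.measurement S X v) (S.times ∩ Set.Iio t))
            (fun ω m => X m t ω) (Xhm t) m l
          =ᵐ[μ] (fun _ => ClockNetwork.errorCov μ (fun ω m => X m t ω) (Xhm t) m l)) ∧
      (∀ t : ℝ, 0 ≤ t →
        ClockNetwork.errorCov μ (fun ω m => X m t ω) (Xh t) = P t ∧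
        ClockNetwork.errorCov μ (fun ω m => X m t ω) (Xhm t) = Pm t) ∧
      -- the unforced filter is uniformly asymptotically stable
      ClockNetwork.IsUniformlyAsymptoticallyStable S.times (fun x : Fin n → ℝ => -α • x)
        (fun t x =>
          ClockNetwork.estimateUpdate (Pm t) (S.link t) (S.variance t) 0 x) ∧
      -- uniformly bounded covariance
      (∃ B : ℝ, ∀ t : ℝ, 0 ≤ t → ∀ m l : Fin n, |P t m l| ≤ B ∧ |Pm t m l| ≤ B) := by
  refine ⟨ClockNetwork.exists_kalmanBucyFilter hα.ne' ε S _, fun Xh Xhm P Pm hF => ?_⟩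
  have h := hmodel.isLinearEstimate_filter hα hE hF
  have hIic : ∀ t, S.times ∩ Set.Iic t ⊆ S.times := fun t => Set.inter_subset_left
  have hIio : ∀ t, S.times ∩ Set.Iio t ⊆ S.times := fun t => Set.inter_subset_left
  refine ⟨fun t ht => ⟨(h t ht).2.isOptimalEstimate hE (hIic t) ht,
      (h t ht).1.isOptimalEstimate hE (hIio t) ht⟩,
    fun t ht m l => ⟨(h t ht).2.condErrorCov_eq hE (hIic t) ht m l,
      (h t ht).1.condErrorCov_eq hE (hIio t) ht m l⟩,
    fun t ht => ⟨(h t ht).2.errorCov_eq ht, (h t ht).1.errorCov_eq ht⟩,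
    ClockNetwork.isUniformlyAsymptoticallyStable_unforced hα hε hE hF.covariance,
    ∑ i, ε i ^ 2 / (2 * α), fun t ht m l => ⟨(h t ht).2.abs_covariance_le hα ht m l,
      (h t ht).1.abs_covariance_le hα ht m l⟩⟩
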